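/- Let $p,q\ge 1$ and $n=p+q$. In $SL_n=SL_n(\mathbb C)$ let $B_n$ be the subgroup of upper triangular matrices, $P_{p,q}$ the subgroup of matrices whose lower left $q\times p$ block is zero, and $L_{p,q}\subset P_{p,q}$ the subgroup of block diagonal matrices with blocks of sizes $p$ and $q$. Let $\pi:SL_n/L_{p,q}\to SL_n/P_{p,q}=\mathrm{Gr}(p,n)$ be the canonical projection, where $gP_{p,q}$ is identified with the span of the first $p$ columns of $g$. For a $p$-element subset $I\subseteq\{1,\dots,n\}$ let the Schubert cell $C_I$ be the $B_n$-orbit of $\mathrm{span}\{e_i: i\in I\}$ in $\mathrm{Gr}(p,n)$. A $(p,q)$-clan is a string $\gamma=(c_1\cdots c_n)$ of symbols $+$, $-$ and natural numbers such that each number that occurs occurs exactly twice and there are $p-q$ more $+$'s than $-$'s; two strings are identified if they have the same signs in the same positions and the same pairs of positions carry equal numbers. Position $i$ has signature $+$ if $c_i=+$ or $c_i$ is the second copy of a number, and signature $-$ otherwise. The base clan of $\gamma$ is obtained by replacing each symbol by its signature. The sect of a base clan $\tau$ is the set of all clans with base clan $\tau$. Let $\gamma_I$ be the clan with $+$ at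 the positions in $I$ and $-$ elsewhere, and let $\Sigma_I$ be its sect. Given $\gamma$, let $s_1<\dots<s_k$ be the positions $\le p$ with signature $-$, let $t_1<\dots<t_k$ be the positions $>p$ with signature $+$, and let $\sigma$ be the permutation exchanging $s_l$ and $t_l$ for all $l$ and fixing all other positions. Put $v_i=e_{\sigma(i)}$ if $c_i=\pm$; and, if $c_i=c_j$ is a number with $i\ne j$, put $v_i=e_{\sigma(i)}+e_{\sigma(j)}$ if $i$ has signature $+$ and $v_i=-e_{\sigma(i)}+e_{\sigma(j)}$ if $i$ has signature $-$. Let $g_\gamma\in SL_n$ be the matrix with columns $v_1,\dots,v_n$ multiplied by an $n$-th root of the inverse of its (non-zero) determinant, and let $R_\gamma=B_n g_\gamma^{-1}L_{p,q}/L_{p,q}$. Then: 1. The $B_n$-orbit $R_\gamma\subset SL_n/L_{p,q}$ does not depend on the choice of the $n$-th root. 2. The map $I\mapsto C_I$ is a bijection from the $p$-element subsets of $\{1,\dots,n\}$ onto the set of $B_n$-orbits in $SL_n/P_{p,q}$. 3. For every $I$, $\pi^{-1}(C_I)=\bigsqcup_{\gamma\in\Sigma_I}R_\gamma$, where the orbits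 $R_\gamma$ for distinct $\gamma\in\Sigma_I$ are pairwise disjoint. 4. The correspondence $C_I\leftrightarrow\Sigma_I$ is a bijection between the Schubert cells and the sects of $(p,q)$-clans. 5. There is a bijection between the sects of $(p,q)$-clans and the lattice paths from $(0,0)$ to $(p,q)$ with unit steps east or north, under which $\Sigma_I$ corresponds to the path whose $i$-th step goes east if $i\in I$ and north if $i\notin I$. -/

import Mathlib

open scoped Classical

noncomputable section

/-! ### The subgroups `B`, `P`, `L` of `SL_n`, `n = p + q` -/

/-- The group `SL_n(ℂ)` with `n = p + q`. -/
abbrev SLn (p q : ℕ) := Matrix.SpecialLinearGroup (Fin (p + q)) ℂ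

/-- Matrices in `SL_n` that are block triangular for the block function `b` form a subgroup. -/
def blockTriangularSubgroup (p q : ℕ) {α : Type} [LinearOrder α] (b : Fin (p + q) → α) :
    Subgroup (SLn p q) where
  carrier := {g | ∀ i j, b j < b i → g i j = 0}
  one_mem' := by
    intro i j h
    have hij : i ≠ j := by rintro rfl; exact lt_irrefl _ h
    simp [hij]
  mul_mem' := by
    intro x y hx hy i j h
    have h1 : Matrix.BlockTriangular (x : Matrix (Fin (p + q)) (Fin (p + q)) ℂ) b :=
      fun i j h => hx i j h
    have h2 : Matrix.BlockTriangular (y : Matrix (Fin (p + q)) (Fin (p + q)) ℂ) b :=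
      fun i j h => hy i j h
    have := h1.mul h2
    simpa using this h
  inv_mem' := by
    intro x hx i j h
    have h1 : Matrix.BlockTriangular (x : Matrix (Fin (p + q)) (Fin (p + q)) ℂ) b :=
      fun i j h => hx i j h
    have hinv : (x : Matrix (Fin (p + q)) (Fin (p + q)) ℂ)⁻¹ = (x⁻¹ : SLn p q) := by
      apply Matrix.inv_eq_right_inv
      rw [← Matrix.SpecialLinearGroup.coe_mul, mul_inv_cancel]
      simp
    have : Invertible (x : Matrix (Fin (p + q)) (Fin (p + q)) ℂ) :=
      Matrix.invertibleOfIsUnitDet _ (by simp)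
    have h2 := Matrix.blockTriangular_inv_of_blockTriangular h1
    rw [hinv] at h2
    exact h2 h

/-- The Borel subgroup `B_n` of upper triangular matrices in `SL_n`. -/
def borelSubgroup (p q : ℕ) : Subgroup (SLn p q) := blockTriangularSubgroup p q (fun i => i)

/-- The parabolic subgroup `P_{p,q}`: the lower left `q × p` block vanishes. -/
def parabolic (p q : ℕ) : Subgroup (SLn p q) :=
  blockTriangularSubgroup p q (fun i => if (i : ℕ) < p then (0 : ℕ) else 1)

/-- The opposite parabolic subgroup: the upper right `p × q` block vanishes. -/
def oppositeParabolic (p q : ℕ) : Subgroup (SLn p q) :=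
  blockTriangularSubgroup p q (fun i => if (i : ℕ) < p then (1 : ℕ) else 0)

/-- The Levi subgroup `L_{p,q}`: both off-diagonal blocks vanish. -/
def levi (p q : ℕ) : Subgroup (SLn p q) := parabolic p q ⊓ oppositeParabolic p q

theorem levi_le_parabolic (p q : ℕ) : levi p q ≤ parabolic p q := inf_le_left

/-- The canonical projection `SL_n / L_{p,q} → SL_n / P_{p,q}`, `g L ↦ g P`. -/
def leviProj (p q : ℕ) : SLn p q ⧸ levi p q → SLn p q ⧸ parabolic p q :=
  Subgroup.quotientMapOfLE (levi_le_parabolic p q)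

/-! ### Schubert cells -/

/-- The span of the first `p` columns of a matrix in `SL_n`. -/
def firstColumns (p q : ℕ) (g : SLn p q) : Submodule ℂ (Fin (p + q) → ℂ) :=
  Submodule.span ℂ {v | ∃ j : Fin (p + q), (j : ℕ) < p ∧ v = fun i => g i j}

theorem firstColumns_mul_le (p q : ℕ) (g h : SLn p q) (hh : h ∈ parabolic p q) :
    firstColumns p q (g * h) ≤ firstColumns p q g := by
  refine Submodule.span_le.2 ?_
  rintro v ⟨j, hj, rfl⟩
  have : (fun i => (g * h) i j) = ∑ k, h k j • (fun i => g i k) := by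
    funext i
    simp [Matrix.mul_apply, mul_comm]
  rw [this]
  refine Submodule.sum_mem _ fun k _ => ?_
  by_cases hk : (k : ℕ) < p
  · exact Submodule.smul_mem _ _ (Submodule.subset_span ⟨k, hk, rfl⟩)
  · have : h k j = 0 := hh k j (by simp [hj, hk])
    rw [this, zero_smul]
    exact Submodule.zero_mem _

/-- The point of the Grassmannian `Gr(p, n)` given by a coset `g P_{p,q}`: the span of the first
`p` columns of `g`. -/
def planeOf (p q : ℕ) : SLn p q ⧸ parabolic p q → Submodule ℂ (Fin (p + q) → ℂ) :=
  Quotient.lift (firstColumns p q) (by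
    intro a b hab
    have h : a⁻¹ * b ∈ parabolic p q := QuotientGroup.leftRel_apply.1 hab
    apply le_antisymm
    · have := firstColumns_mul_le p q b (a⁻¹ * b)⁻¹ (inv_mem h)
      simpa using this
    · have := firstColumns_mul_le p q a (a⁻¹ * b) h
      simpa using this)

/-- The `p`-element subsets `I` of the `n` standard basis vectors, given by their indices. -/
abbrev PSubset (p q : ℕ) := {I : Finset (Fin (p + q)) // I.card = p}

/-- The coordinate subspace spanned by the `e_i` with `i ∈ I`. -/
def coordPlane {p q : ℕ} (I : PSubset p q) : Submodule ℂ (Fin (p + q) → ℂ) :=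
  Submodule.span ℂ {v | ∃ i ∈ I.1, v = Pi.single i 1}

/-- The Schubert cell `C_I` in `SL_n / P_{p,q} = Gr(p, n)`: the `B_n`-orbit of the coordinate
subspace of `I`. -/
def schubertCell {p q : ℕ} (I : PSubset p q) : Set (SLn p q ⧸ parabolic p q) :=
  {x | ∃ b ∈ borelSubgroup p q, planeOf p q x =
    (coordPlane I).map (b : Matrix (Fin (p + q)) (Fin (p + q)) ℂ).mulVecLin}

/-- The set of all `B_n`-orbits in `SL_n / P_{p,q}`. -/
def schubertCells (p q : ℕ) : Set (Set (SLn p q ⧸ parabolic p q)) :=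
  Set.range fun x => MulAction.orbit (borelSubgroup p q) x

/-! ### Clans -/

/-- A symbol of a clan: `+`, `-` or a natural number. -/
inductive ClanSymbol where
  | plus : ClanSymbol
  | minus : ClanSymbol
  | num (k : ℕ) : ClanSymbol

/-- A string `c_1 … c_n` of symbols, `n = p + q`, in which every number occurs exactly twice
or not at all, with `p - q` more symbols `+` than symbols `-`. -/
structure PreClan (p q : ℕ) where
  symbol : Fin (p + q) → ClanSymbol
  paired : ∀ i k, symbol i = .num k → ∃! j, j ≠ i ∧ symbol j = symbol i
  count : ((Finset.univ.filter fun i => symbol i = .plus).card : ℤ)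
    - ((Finset.univ.filter fun i => symbol i = .minus).card : ℤ) = (p : ℤ) - q

namespace PreClan

variable {p q : ℕ}

/-- Two strings are equivalent if they have the same signs in the same positions and the same
pairs of positions carry equal numbers. -/
instance setoid (p q : ℕ) : Setoid (PreClan p q) where
  r c d := (∀ i, c.symbol i = .plus ↔ d.symbol i = .plus) ∧
    (∀ i, c.symbol i = .minus ↔ d.symbol i = .minus) ∧
    (∀ i j, c.symbol i = c.symbol j ↔ d.symbol i = d.symbol j)
  iseqv :=
    { refl := fun _ => ⟨fun _ => Iff.rfl, fun _ => Iff.rfl, fun _ _ => Iff.rfl⟩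
      symm := fun h => ⟨fun i => (h.1 i).symm, fun i => (h.2.1 i).symm,
        fun i j => (h.2.2 i j).symm⟩
      trans := fun h h' => ⟨fun i => (h.1 i).trans (h'.1 i), fun i => (h.2.1 i).trans (h'.2.1 i),
        fun i j => (h.2.2 i j).trans (h'.2.2 i j)⟩ }

/-- The positions `i` and `j` carry the two copies of one natural number. -/
def Match (c : PreClan p q) (i j : Fin (p + q)) : Prop :=
  i ≠ j ∧ c.symbol i = c.symbol j ∧ c.symbol i ≠ .plus ∧ c.symbol i ≠ .minus

/-- The position `i` has signature `+` in the default signed clan: it carries `+` or the second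
copy of a natural number. All other positions have signature `-`. -/
def Pos (c : PreClan p q) (i : Fin (p + q)) : Prop :=
  c.symbol i = .plus ∨ ∃ j, j < i ∧ c.Match i j

theorem Match.symm {c : PreClan p q} {i j : Fin (p + q)} (h : c.Match i j) : c.Match j i :=
  ⟨h.1.symm, h.2.1.symm, h.2.1 ▸ h.2.2.1, h.2.1 ▸ h.2.2.2⟩

theorem Match.unique {c : PreClan p q} {i j k : Fin (p + q)} (h : c.Match i j)
    (h' : c.Match i k) : j = k := by
  obtain ⟨m, hm⟩ : ∃ m, c.symbol i = .num m := by
    cases hs : c.symbol i with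
    | plus => exact absurd hs h.2.2.1
    | minus => exact absurd hs h.2.2.2
    | num m => exact ⟨m, rfl⟩
  exact (c.paired i m hm).unique ⟨h.1.symm, h.2.1.symm⟩ ⟨h'.1.symm, h'.2.1.symm⟩

theorem exists_match {c : PreClan p q} {i : Fin (p + q)} (h : c.symbol i ≠ .plus)
    (h' : c.symbol i ≠ .minus) : ∃ j, c.Match i j := by
  obtain ⟨m, hm⟩ : ∃ m, c.symbol i = .num m := by
    cases hs : c.symbol i with
    | plus => exact absurd hs h
    | minus => exact absurd hs h'
    | num m => exact ⟨m, rfl⟩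
  obtain ⟨j, hj, -⟩ := c.paired i m hm
  exact ⟨j, hj.1.symm, hj.2.symm, h, h'⟩

/-- The position carrying the same natural number as `i`; a position with a sign is its own
mate. -/
def mate (c : PreClan p q) (i : Fin (p + q)) : Fin (p + q) :=
  if h : ∃ j, c.Match i j then h.choose else i

theorem match_mate {c : PreClan p q} {i j : Fin (p + q)} (h : c.Match i j) : c.mate i = j := by
  have hex : ∃ j, c.Match i j := ⟨j, h⟩
  rw [mate, dif_pos hex]
  exact hex.choose_spec.unique h

theorem mate_eq_self {c : PreClan p q} {i : Fin (p + q)} (h : ¬ ∃ j, c.Match i j) :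
    c.mate i = i := by
  rw [mate, dif_neg h]

theorem mate_mate (c : PreClan p q) (i : Fin (p + q)) : c.mate (c.mate i) = i := by
  by_cases h : ∃ j, c.Match i j
  · obtain ⟨j, hj⟩ := h
    rw [match_mate hj, match_mate hj.symm]
  · rw [mate_eq_self h, mate_eq_self h]

theorem match_eq {c d : PreClan p q} (h : c ≈ d) : c.Match = d.Match := by
  obtain ⟨h1, h2, h3⟩ := h
  funext i j
  simp only [Match, h3 i j, Ne, h1 i, h2 i]

theorem pos_eq {c d : PreClan p q} (h : c ≈ d) : c.Pos = d.Pos := by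
  funext i
  simp only [Pos, match_eq h, h.1 i]

theorem mate_eq {c d : PreClan p q} (h : c ≈ d) : c.mate = d.mate := by
  funext i
  simp only [mate, match_eq h]

theorem pos_count (c : PreClan p q) : (Finset.univ.filter c.Pos).card = p := by
  have hc := c.count
  have hA : (Finset.univ.filter c.Pos).card
      = (Finset.univ.filter fun i => c.symbol i = .plus).card
        + (Finset.univ.filter fun i => ∃ j, j < i ∧ c.Match i j).card := by
    rw [← Finset.card_union_of_disjoint]
    · congr 1
      ext i
      simp [Pos]
    · rw [Finset.disjoint_filter]
      rintro i - h ⟨j, -, hj⟩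
      exact hj.2.2.1 h
  have hB : (Finset.univ.filter fun i => ¬ c.Pos i).card
      = (Finset.univ.filter fun i => c.symbol i = .minus).card
        + (Finset.univ.filter fun i => ∃ j, i < j ∧ c.Match i j).card := by
    rw [← Finset.card_union_of_disjoint]
    · congr 1
      ext i
      simp only [Finset.mem_filter, Finset.mem_univ, true_and, Finset.mem_union, Pos, not_or]
      constructor
      · rintro ⟨h1, h2⟩
        by_cases h3 : c.symbol i = .minus
        · exact Or.inl h3
        · obtain ⟨j, hj⟩ := exists_match h1 h3
          refine Or.inr ⟨j, ?_, hj⟩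
          rcases lt_trichotomy i j with h | h | h
          · exact h
          · exact absurd h hj.1
          · exact absurd ⟨j, h, hj⟩ h2
      · rintro (h | ⟨j, hij, hj⟩)
        · refine ⟨by simp [h], ?_⟩
          rintro ⟨j, -, hj⟩
          exact hj.2.2.2 h
        · refine ⟨hj.2.2.1, ?_⟩
          rintro ⟨k, hk, hk'⟩
          rw [hj.unique hk'] at hij
          exact lt_asymm hij hk
    · rw [Finset.disjoint_filter]
      rintro i - h ⟨j, -, hj⟩
      exact hj.2.2.2 h
  have hC : (Finset.univ.filter fun i => ∃ j, j < i ∧ c.Match i j).card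
      = (Finset.univ.filter fun i => ∃ j, i < j ∧ c.Match i j).card := by
    refine Finset.card_bij' (fun i _ => c.mate i) (fun i _ => c.mate i) ?_ ?_ ?_ ?_
    · intro i hi
      obtain ⟨j, hj, hm⟩ := (Finset.mem_filter.1 hi).2
      rw [match_mate hm]
      exact Finset.mem_filter.2 ⟨Finset.mem_univ _, i, hj, hm.symm⟩
    · intro i hi
      obtain ⟨j, hj, hm⟩ := (Finset.mem_filter.1 hi).2
      rw [match_mate hm]
      exact Finset.mem_filter.2 ⟨Finset.mem_univ _, i, hj, hm.symm⟩
    · intro i _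
      exact c.mate_mate i
    · intro i _
      exact c.mate_mate i
  have hD := Finset.card_filter_add_card_filter_not (s := (Finset.univ : Finset (Fin (p + q))))
    c.Pos
  rw [Finset.card_univ, Fintype.card_fin] at hD
  omega

/-- The string with `+` at the positions in `I` and `-` at all others. -/
def ofPSubset (I : PSubset p q) : PreClan p q where
  symbol i := if i ∈ I.1 then .plus else .minus
  paired i k h := by split_ifs at h
  count := by
    have h1 : (Finset.univ.filter fun i =>
        (if i ∈ I.1 then ClanSymbol.plus else .minus) = .plus) = I.1 := by
      ext i; by_cases h : i ∈ I.1 <;> simp [h]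
    have h2 : (Finset.univ.filter fun i =>
        (if i ∈ I.1 then ClanSymbol.plus else .minus) = .minus) = I.1ᶜ := by
      ext i; by_cases h : i ∈ I.1 <;> simp [h]
    rw [h1, h2, Finset.card_compl, I.2, Fintype.card_fin]
    push_cast [Nat.add_sub_cancel_left]
    ring

/-- The string obtained by replacing every symbol by its signature in the default signed clan. -/
def base (c : PreClan p q) : PreClan p q := ofPSubset ⟨Finset.univ.filter c.Pos, c.pos_count⟩

/-- The positions `i ≤ p` with signature `-` (positions are counted from `0` in Lean). -/
def setS (c : PreClan p q) : Finset (Fin (p + q)) :=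
  Finset.univ.filter fun i => (i : ℕ) < p ∧ ¬ c.Pos i

/-- The positions `i > p` with signature `+`. -/
def setT (c : PreClan p q) : Finset (Fin (p + q)) :=
  Finset.univ.filter fun i => ¬ (i : ℕ) < p ∧ c.Pos i

theorem card_setS (c : PreClan p q) : c.setS.card = c.setT.card := by
  have h1 := c.pos_count
  have h2 : (Finset.univ.filter fun i : Fin (p + q) => (i : ℕ) < p).card = p := by
    rw [Fin.card_filter_val_lt]
    omega
  have h3 := Finset.card_filter_add_card_filter_not
    (s := Finset.univ.filter fun i : Fin (p + q) => (i : ℕ) < p) c.Pos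
  have h4 := Finset.card_filter_add_card_filter_not
    (s := Finset.univ.filter c.Pos) (fun i : Fin (p + q) => (i : ℕ) < p)
  simp only [Finset.filter_filter] at h3 h4
  have h5 : (Finset.univ.filter fun i : Fin (p + q) => (i : ℕ) < p ∧ c.Pos i)
      = (Finset.univ.filter fun i : Fin (p + q) => c.Pos i ∧ (i : ℕ) < p) :=
    Finset.filter_congr fun i _ => and_comm
  have h6 : c.setT = (Finset.univ.filter fun i : Fin (p + q) => c.Pos i ∧ ¬ (i : ℕ) < p) :=
    Finset.filter_congr fun i _ => and_comm
  rw [h6, setS]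
  rw [h5] at h3
  omega

end PreClan

/-- For finite sets `S = {s_1 < ⋯ < s_k}` and `T = {t_1 < ⋯ < t_k}`, the map that exchanges `s_l`
with `t_l` for every `l` and fixes everything else. -/
def exchange {n : ℕ} (S T : Finset (Fin n)) (h : S.card = T.card) (i : Fin n) : Fin n :=
  if hS : i ∈ S then T.orderEmbOfFin h.symm ((S.orderIsoOfFin rfl).symm ⟨i, hS⟩)
  else if hT : i ∈ T then S.orderEmbOfFin rfl ((T.orderIsoOfFin h.symm).symm ⟨i, hT⟩)
  else i

theorem exchange_involutive {n : ℕ} (S T : Finset (Fin n)) (h : S.card = T.card)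
    (hd : Disjoint S T) : Function.Involutive (exchange S T h) := by
  intro i
  by_cases hS : i ∈ S
  · have hm : T.orderEmbOfFin h.symm ((S.orderIsoOfFin rfl).symm ⟨i, hS⟩) ∈ T :=
      Finset.orderEmbOfFin_mem _ _ _
    have hn : T.orderEmbOfFin h.symm ((S.orderIsoOfFin rfl).symm ⟨i, hS⟩) ∉ S :=
      fun h' => Finset.disjoint_left.1 hd h' hm
    rw [exchange, exchange, dif_pos hS, dif_neg hn, dif_pos hm]
    have : (⟨_, hm⟩ : T) = T.orderIsoOfFin h.symm ((S.orderIsoOfFin rfl).symm ⟨i, hS⟩) :=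
      Subtype.ext rfl
    rw [this, OrderIso.symm_apply_apply]
    exact congrArg Subtype.val ((S.orderIsoOfFin rfl).apply_symm_apply ⟨i, hS⟩)
  · by_cases hT : i ∈ T
    · have hm : S.orderEmbOfFin rfl ((T.orderIsoOfFin h.symm).symm ⟨i, hT⟩) ∈ S :=
        Finset.orderEmbOfFin_mem _ _ _
      rw [exchange, exchange, dif_neg hS, dif_pos hT, dif_pos hm]
      have : (⟨_, hm⟩ : S) = S.orderIsoOfFin rfl ((T.orderIsoOfFin h.symm).symm ⟨i, hT⟩) :=
        Subtype.ext rfl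
      rw [this, OrderIso.symm_apply_apply]
      exact congrArg Subtype.val ((T.orderIsoOfFin h.symm).apply_symm_apply ⟨i, hT⟩)
    · simp [exchange, hS, hT]

namespace PreClan

variable {p q : ℕ}

/-- The default permutation `σ` of the clan. -/
def defaultPerm (c : PreClan p q) : Equiv.Perm (Fin (p + q)) :=
  (exchange_involutive c.setS c.setT c.card_setS (by
    rw [setS, setT, Finset.disjoint_filter]
    exact fun i _ h h' => h'.1 h.1)).toPerm

/-- The vector `v_i` of the default flag: `e_{σ(i)}` if `c_i = ±`, `e_{σ(i)} + e_{σ(j)}` if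
`c_i = c_j` is a number and `c_i` has signature `+`, and `-e_{σ(i)} + e_{σ(j)}` if `c_i = c_j` is
a number and `c_i` has signature `-`. -/
def flagVector (c : PreClan p q) (i : Fin (p + q)) : Fin (p + q) → ℂ :=
  if c.symbol i = .plus ∨ c.symbol i = .minus then Pi.single (c.defaultPerm i) 1
  else if c.Pos i then
    Pi.single (c.defaultPerm i) 1 + Pi.single (c.defaultPerm (c.mate i)) 1
  else
    -Pi.single (c.defaultPerm i) 1 + Pi.single (c.defaultPerm (c.mate i)) 1

/-- The matrix whose `i`-th column is `v_i`. -/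
def flagMatrix (c : PreClan p q) : Matrix (Fin (p + q)) (Fin (p + q)) ℂ :=
  Matrix.of fun k i => c.flagVector i k

theorem defaultPerm_eq {c d : PreClan p q} (h : c ≈ d) : c.defaultPerm = d.defaultPerm := by
  have hS : c.setS = d.setS := by simp only [setS, pos_eq h]
  have hT : c.setT = d.setT := by simp only [setT, pos_eq h]
  have key : ∀ (S S' T T' : Finset (Fin (p + q))) (h : S.card = T.card) (h' : S'.card = T'.card),
      S = S' → T = T' → exchange S T h = exchange S' T' h' := by
    rintro S _ T _ h h' rfl rfl
    rfl
  exact Equiv.ext fun i => congrFun (key _ _ _ _ c.card_setS d.card_setS hS hT) i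

theorem flagMatrix_eq {c d : PreClan p q} (h : c ≈ d) : c.flagMatrix = d.flagMatrix := by
  ext k i
  simp only [flagMatrix, Matrix.of_apply, flagVector, h.1, h.2.1, pos_eq h, mate_eq h,
    defaultPerm_eq h]

theorem det_flagMatrix_ne_zero (c : PreClan p q) : c.flagMatrix.det ≠ 0 := by
  intro h0
  obtain ⟨x, hx, hx0⟩ := Matrix.exists_mulVec_eq_zero_iff.2 h0
  apply hx
  have key : ∀ k, ∑ i, c.flagVector i (c.defaultPerm k) * x i = 0 := fun k =>
    congrFun hx0 (c.defaultPerm k)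
  have inj : ∀ a b, c.defaultPerm a = c.defaultPerm b ↔ a = b := fun a b =>
    c.defaultPerm.injective.eq_iff
  have signs : ∀ i, (c.symbol i = .plus ∨ c.symbol i = .minus) ↔ ¬ ∃ j, c.Match i j := by
    intro i
    constructor
    · rintro (h | h) ⟨j, hj⟩
      · exact hj.2.2.1 h
      · exact hj.2.2.2 h
    · intro h
      by_contra h'
      push Not at h'
      exact h (exists_match h'.1 h'.2)
  have entry : ∀ i k, c.flagVector i (c.defaultPerm k) =
      (if i = k then (if (∃ j, c.Match i j) ∧ ¬ c.Pos i then -1 else 1) else 0)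
      + (if i = c.mate k then (if ∃ j, c.Match i j then 1 else 0) else 0) := by
    intro i k
    have hmk : (k = c.mate i) ↔ (i = c.mate k) :=
      ⟨fun h => by rw [h, mate_mate], fun h => by rw [h, mate_mate]⟩
    rw [flagVector]
    by_cases h : ∃ j, c.Match i j
    · rw [if_neg (by rw [signs]; exact not_not.2 h)]
      by_cases hp : c.Pos i
      · simp only [hp, if_true, Pi.add_apply, Pi.single_apply, inj, h, hmk, eq_comm (a := k) (b := i)]
        simp
      · simp only [hp, if_false, Pi.add_apply, Pi.neg_apply, Pi.single_apply, inj, h, hmk,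
          eq_comm (a := k) (b := i)]
        by_cases hik : i = k <;> simp [hik]
    · rw [if_pos ((signs i).2 h)]
      simp only [h, Pi.single_apply, inj, eq_comm (a := k) (b := i)]
      simp
  have eqn : ∀ k, (if (∃ j, c.Match k j) ∧ ¬ c.Pos k then -1 else 1) * x k
      + (if ∃ j, c.Match (c.mate k) j then 1 else 0) * x (c.mate k) = 0 := by
    intro k
    have := key k
    simp only [entry, add_mul, Finset.sum_add_distrib, ite_mul, zero_mul, Finset.sum_ite_eq',
      Finset.mem_univ, if_true] at this
    simpa only [ite_mul, zero_mul] using this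
  have lt_case : ∀ i j, i < j → c.Match i j → x i = 0 ∧ x j = 0 := by
    intro i j hij hm
    have hi : ¬ c.Pos i := by
      rintro (h | ⟨k, hk, hk'⟩)
      · exact hm.2.2.1 h
      · rw [hm.unique hk'] at hij
        exact lt_asymm hij hk
    have hj : c.Pos j := Or.inr ⟨i, hij, hm.symm⟩
    have e1 := eqn i
    have e2 := eqn j
    have hei : ∃ k, c.Match i k := ⟨j, hm⟩
    have hej : ∃ k, c.Match j k := ⟨i, hm.symm⟩
    rw [match_mate hm] at e1
    rw [match_mate hm.symm] at e2
    simp only [hei, hej, hi, hj, not_true_eq_false, not_false_eq_true, and_true, and_false,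
      if_true, if_false] at e1 e2
    constructor
    · linear_combination (e2 - e1) / 2
    · linear_combination (e1 + e2) / 2
  funext k
  by_cases h : ∃ j, c.Match k j
  · obtain ⟨j, hj⟩ := h
    rcases lt_trichotomy k j with h' | h' | h'
    · exact (lt_case k j h' hj).1
    · exact absurd h' hj.1
    · exact (lt_case j k h' hj.symm).2
  · have e := eqn k
    rw [mate_eq_self h] at e
    simpa [h] using e

end PreClan

/-- The `(p,q)`-clans: strings up to equivalence. -/
def Clan (p q : ℕ) := Quotient (PreClan.setoid p q)

namespace Clan

variable {p q : ℕ}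

/-- The base clan of a clan. -/
def base : Clan p q → Clan p q :=
  Quotient.map PreClan.base (by
    intro c d h
    have : c.base = d.base := by
      simp only [PreClan.base, PreClan.pos_eq h]
    rw [this])

/-- The matrix whose columns are the vectors of the default flag of the clan. -/
def flagMatrix : Clan p q → Matrix (Fin (p + q)) (Fin (p + q)) ℂ :=
  Quotient.lift PreClan.flagMatrix fun _ _ h => PreClan.flagMatrix_eq h

theorem det_flagMatrix_ne_zero (γ : Clan p q) : γ.flagMatrix.det ≠ 0 := by
  induction γ using Quotient.inductionOn with
  | h c => exact c.det_flagMatrix_ne_zero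

/-- The default matrices of a clan `γ`: the elements `ζ • ĝ` of `SL_n`, where the columns of `ĝ`
are the vectors of the default flag and `ζ` is an `n`-th root of `1 / det ĝ`. -/
def IsDefaultMatrix (γ : Clan p q) (g : SLn p q) : Prop :=
  ∃ ζ : ℂ, ζ ^ (p + q) = 1 / γ.flagMatrix.det ∧
    (g : Matrix (Fin (p + q)) (Fin (p + q)) ℂ) = ζ • γ.flagMatrix

theorem exists_isDefaultMatrix (γ : Clan p q) : ∃ g, γ.IsDefaultMatrix g := by
  have hd := γ.det_flagMatrix_ne_zero
  obtain ⟨ζ, hζ⟩ : ∃ ζ : ℂ, ζ ^ (p + q) = 1 / γ.flagMatrix.det := by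
    rcases Nat.eq_zero_or_pos (p + q) with h | h
    · have : IsEmpty (Fin (p + q)) := by rw [h]; infer_instance
      exact ⟨1, by simp [Matrix.det_isEmpty]⟩
    · exact IsAlgClosed.exists_pow_nat_eq _ h
  refine ⟨⟨ζ • γ.flagMatrix, ?_⟩, ζ, hζ, rfl⟩
  rw [Matrix.det_smul, Fintype.card_fin, hζ]
  field_simp

/-- A choice of a default matrix `g_γ`. -/
def defaultMatrix (γ : Clan p q) : SLn p q := γ.exists_isDefaultMatrix.choose

/-- The `B_n`-orbit `R_γ = B_n g_γ⁻¹ L_{p,q} / L_{p,q}` in `SL_n / L_{p,q}`. -/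
def borelOrbit (γ : Clan p q) : Set (SLn p q ⧸ levi p q) :=
  MulAction.orbit (borelSubgroup p q) ((γ.defaultMatrix⁻¹ : SLn p q) : SLn p q ⧸ levi p q)

/-- The sect of a base clan `τ`: all clans with base clan `τ`. -/
def sect (τ : Clan p q) : Set (Clan p q) := {γ | γ.base = τ}

/-- The clan `γ_I` with `+` at the positions in `I` and `-` at all others. -/
def ofPSubset (I : PSubset p q) : Clan p q := Quotient.mk _ (PreClan.ofPSubset I)

/-- The sect `Σ_I` of the base clan `γ_I`. -/
def sectOf (I : PSubset p q) : Set (Clan p q) := sect (ofPSubset I)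

end Clan

/-- The set of all sects of `(p,q)`-clans. -/
def sects (p q : ℕ) : Set (Set (Clan p q)) := Set.range fun γ : Clan p q => Clan.sect γ.base

/-! ### Lattice paths -/

/-- A lattice path from `(0, 0)` to `(p, q)` with unit steps to the east or to the north, given by
the points it visits. -/
structure LatticePath (p q : ℕ) where
  pt : Fin (p + q + 1) → ℕ × ℕ
  start : pt 0 = (0, 0)
  finish : pt (Fin.last (p + q)) = (p, q)
  step : ∀ i : Fin (p + q), pt i.succ = pt i.castSucc + (1, 0) ∨ pt i.succ = pt i.castSucc + (0, 1)

end

/-!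
Let `J = diag(1, …, 1, -1, …, -1)` with `p` entries `1`. The Levi subgroup is the centralizer of `J`
in `SL_n`, so `h L ↦ h J h⁻¹` identifies `SL_n / L` with the involutory matrices of trace `p - q`,
and Borel orbits become conjugacy classes under upper triangular matrices. A clan `γ` gives such a
matrix `T_γ` (`PreClan.involution`), a signed permutation matrix: `e_i ↦ ± e_i` at the signs, and
`e_i ↔ e_j` at the pairs. The vectors of the default flag satisfy `g_γ T_γ = J g_γ`
(`PreClan.flagMatrix_mul_involution`), so `R_γ` is the class of `T_γ`; this description
(`mem_borelOrbit_iff`) does not involve the choice of a root.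

The `R_γ` are pairwise disjoint, because an upper triangular `a` with `a T_δ = T_γ a` forces the
two underlying permutations, and then the signs, to agree (`PreClan.equiv_of_conj`). They cover
`SL_n / L`, because every involutory matrix `T` is conjugate under the upper triangular group to a
signed involution of the basis (`exists_conj_normalOn_univ`). For this, let `i` be the least index
not yet treated. If `T e_i` is a multiple of `e_i`, it is split off together with a `T`-stable
complement; otherwise `T e_i` replaces the basis vector of its highest index `j`, and the plane
spanned by `e_i` and `T e_i` is split off.

The image of `R_γ` in the Grassmannian consists of translates of the fixed space of `T_γ`, and a
unipotent upper triangular matrix carries the coordinate plane of the positions with signature `+`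
to that fixed space (`leviProj_mem_schubertCell`). Schubert cells of distinct `I` are disjoint, so
the preimage of `C_I` is the union of those `R_γ` for which `γ` has the base clan `γ_I`; as the
`R_γ` cover `SL_n / L`, the cells `C_I` exhaust the Borel orbits in the Grassmannian. Schubert
cells, sects and lattice paths are thus all indexed by the `p`-element subsets.
-/

noncomputable section

open Matrix

/-! ### Involutory matrices up to upper triangular conjugation -/

section NormalForm


variable {K : Type*} [Field K] {n : ℕ}

/-- The matrix `T` acts on the basis vectors `e_j`, `j ∈ S`, and on the dual basis vectors with
index in `S`, as one and the same signed involution of `S`, in which only fixed points may carry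
the sign `-1`. -/
def NormalOn (T : Matrix (Fin n) (Fin n) K) (S : Finset (Fin n)) : Prop :=
  ∀ j ∈ S, ∃ i ∈ S, ∃ ε : K, (ε = 1 ∨ ε = -1) ∧ (i ≠ j → ε = 1) ∧
    T *ᵥ Pi.single j 1 = ε • Pi.single i 1 ∧ Pi.single j 1 ᵥ* T = ε • Pi.single i 1

theorem NormalOn.apply_eq_zero {T : Matrix (Fin n) (Fin n) K} {S : Finset (Fin n)}
    (h : NormalOn T S) {j k : Fin n} (hj : j ∈ S) (hk : k ∉ S) : T k j = 0 ∧ T j k = 0 := by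
  obtain ⟨i, hi, ε, -, -, h1, h2⟩ := h j hj
  have hki : k ≠ i := by rintro rfl; exact hk hi
  have h1 := congrFun h1 k
  have h2 := congrFun h2 k
  simp [hki] at h1 h2
  exact ⟨h1, h2⟩

theorem inv_mulVec_of_eq {b : Matrix (Fin n) (Fin n) K} (hb : IsUnit b.det) {x y : Fin n → K}
    (h : b *ᵥ x = y) : b⁻¹ *ᵥ y = x := by
  rw [← h, mulVec_mulVec, nonsing_inv_mul b hb, one_mulVec]

theorem vecMul_inv_of_eq {b : Matrix (Fin n) (Fin n) K} (hb : IsUnit b.det) {x y : Fin n → K}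
    (h : x ᵥ* b = y) : y ᵥ* b⁻¹ = x := by
  rw [← h, vecMul_vecMul, mul_nonsing_inv b hb, vecMul_one]

theorem NormalOn.conj {T b : Matrix (Fin n) (Fin n) K} {S : Finset (Fin n)} (h : NormalOn T S)
    (hb : IsUnit b.det) (h1 : ∀ s ∈ S, b *ᵥ Pi.single s 1 = Pi.single s 1)
    (h2 : ∀ s ∈ S, Pi.single s 1 ᵥ* b = Pi.single s 1) : NormalOn (b⁻¹ * T * b) S := by
  intro j hj
  obtain ⟨i, hi, ε, hε, hij, hc, hr⟩ := h j hj
  refine ⟨i, hi, ε, hε, hij, ?_, ?_⟩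
  · rw [← mulVec_mulVec, ← mulVec_mulVec, h1 j hj, hc, mulVec_smul,
      inv_mulVec_of_eq hb (h1 i hi)]
  · rw [← vecMul_vecMul, ← vecMul_vecMul, vecMul_inv_of_eq hb (h2 j hj), hr, smul_vecMul,
      h2 i hi]

theorem updateRow_one_mulVec_single (i k : Fin n) (φ : Fin n → K)
    (hφ : φ k = if k = i then 1 else 0) :
    updateRow (1 : Matrix (Fin n) (Fin n) K) i φ *ᵥ Pi.single k 1 = Pi.single k 1 := by
  ext m
  by_cases hm : m = i
  · subst hm
    simp [hφ, Pi.single_apply, eq_comm]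
  · simp [hm, one_apply, Pi.single_apply]

theorem single_vecMul_updateRow_one (i : Fin n) (φ : Fin n → K) :
    Pi.single i 1 ᵥ* updateRow (1 : Matrix (Fin n) (Fin n) K) i φ = φ := by
  ext m
  simp

theorem single_vecMul_updateRow_one_of_ne {i k : Fin n} (hk : k ≠ i) (φ : Fin n → K) :
    Pi.single k 1 ᵥ* updateRow (1 : Matrix (Fin n) (Fin n) K) i φ = Pi.single k 1 := by
  ext m
  simp [hk, one_apply, Pi.single_apply, eq_comm]

/-- If `i` is the least index outside `S`, replacing the `i`-th row of the identity by a row vector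
`φ` that vanishes on `S` and has `φ i = 1` gives the inverse of an upper triangular matrix. -/
theorem updateRow_one_upper {S : Finset (Fin n)} {i : Fin n} (hi : ∀ k < i, k ∈ S)
    {φ : Fin n → K} (hS : ∀ s ∈ S, φ s = 0) (h1 : φ i = 1) :
    BlockTriangular (updateRow (1 : Matrix (Fin n) (Fin n) K) i φ)⁻¹ id ∧
      IsUnit (updateRow (1 : Matrix (Fin n) (Fin n) K) i φ).det := by
  have ht : BlockTriangular (updateRow (1 : Matrix (Fin n) (Fin n) K) i φ) id := by
    intro a b (hab : b < a)
    by_cases ha : a = i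
    · subst ha
      simpa using hS b (hi b hab)
    · simp [ha, one_apply, hab.ne']
  have hd : IsUnit (updateRow (1 : Matrix (Fin n) (Fin n) K) i φ).det := by
    rw [det_of_isUpperTriangular ht, Finset.prod_eq_one]
    · exact isUnit_one
    · intro a _
      by_cases ha : a = i
      · subst ha; simpa using h1
      · simp [ha]
  have := invertibleOfIsUnitDet _ hd
  exact ⟨blockTriangular_inv_of_blockTriangular ht, hd⟩

theorem NormalOn.insert_pair {T : Matrix (Fin n) (Fin n) K} {S : Finset (Fin n)}
    (h : NormalOn T S) {i j : Fin n} {ε : K} (hε : ε = 1 ∨ ε = -1) (hij : i ≠ j → ε = 1)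
    (h1 : T *ᵥ Pi.single i 1 = ε • Pi.single j 1) (h2 : T *ᵥ Pi.single j 1 = ε • Pi.single i 1)
    (h3 : Pi.single i 1 ᵥ* T = ε • Pi.single j 1) (h4 : Pi.single j 1 ᵥ* T = ε • Pi.single i 1) :
    NormalOn T (insert i (insert j S)) := by
  intro k hk
  rcases Finset.mem_insert.1 hk with rfl | hk
  · exact ⟨j, by simp, ε, hε, fun h => hij h.symm, h1, h3⟩
  rcases Finset.mem_insert.1 hk with rfl | hk
  · exact ⟨i, by simp, ε, hε, hij, h2, h4⟩
  · obtain ⟨m, hm, H⟩ := h k hk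
    exact ⟨m, by simp [hm], H⟩

/-- If `T` is already normal on `S` and exchanges `e_i` and `e_j` up to the sign `ε`, where `i` is
the least index outside `S`, then an upper triangular conjugation makes `T` normal on
`S ∪ {i, j}`. The row vector `φ`, which becomes the `i`-th dual basis vector, is an eigenvector of
`T` if `i = j`; otherwise `T` exchanges it with the `j`-th dual basis vector. So the common kernel
of the two is a `T`-stable complement of the span of `e_i` and `e_j`. -/
theorem NormalOn.extend {T : Matrix (Fin n) (Fin n) K} {S : Finset (Fin n)} (h : NormalOn T S)
    {i j : Fin n} (hi : ∀ k < i, k ∈ S) (hiS : i ∉ S)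
    {ε : K} (hε : ε = 1 ∨ ε = -1) (hij : i ≠ j → ε = 1)
    (h1 : T *ᵥ Pi.single i 1 = ε • Pi.single j 1) (h2 : T *ᵥ Pi.single j 1 = ε • Pi.single i 1)
    {φ : Fin n → K} (hφS : ∀ s ∈ S, φ s = 0) (hφi : φ i = 1) (hφj : i ≠ j → φ j = 0)
    (h3 : i = j → φ ᵥ* T = ε • φ)
    (h4 : i ≠ j → Pi.single j 1 ᵥ* T = φ ∧ φ ᵥ* T = Pi.single j 1) :
    ∃ b : Matrix (Fin n) (Fin n) K, BlockTriangular b id ∧ IsUnit b.det ∧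
      NormalOn (b⁻¹ * T * b) (insert i (insert j S)) := by
  obtain ⟨hbt, hc⟩ := updateRow_one_upper hi hφS hφi
  have hs : ∀ s ∈ S, s ≠ i := by rintro s hs rfl; exact hiS hs
  have ci := updateRow_one_mulVec_single i i φ (by simp [hφi])
  have cj := updateRow_one_mulVec_single i j φ (by
    by_cases hji : j = i
    · simp [hji, hφi]
    · simp [hji, hφj (Ne.symm hji)])
  have cS : ∀ s ∈ S, _ := fun s h => updateRow_one_mulVec_single i s φ (by simp [hs s h, hφS s h])
  have ri := single_vecMul_updateRow_one i φ
  have rk : ∀ k, k ≠ i → _ := fun k h => single_vecMul_updateRow_one_of_ne (K := K) h φ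
  set c := updateRow (1 : Matrix (Fin n) (Fin n) K) i φ with hcdef
  have hb : IsUnit (c⁻¹).det := isUnit_nonsing_inv_det c hc
  refine ⟨c⁻¹, hbt, hb, ?_⟩
  have hN := h.conj hb (fun s hs => inv_mulVec_of_eq hc (cS s hs))
    (fun s h => vecMul_inv_of_eq hc (rk s (hs s h)))
  rw [nonsing_inv_nonsing_inv c hc] at hN ⊢
  refine hN.insert_pair hε hij ?_ ?_ ?_ ?_
  · rw [← mulVec_mulVec, ← mulVec_mulVec, inv_mulVec_of_eq hc ci, h1, mulVec_smul, cj]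
  · rw [← mulVec_mulVec, ← mulVec_mulVec, inv_mulVec_of_eq hc cj, h2, mulVec_smul, ci]
  · rw [← vecMul_vecMul, ← vecMul_vecMul, ri]
    by_cases hij' : i = j
    · rw [h3 hij', smul_vecMul, vecMul_inv_of_eq hc ri, hij']
    · rw [(h4 hij').2, vecMul_inv_of_eq hc (rk j (Ne.symm hij')), hij hij', one_smul]
  · rw [← vecMul_vecMul, ← vecMul_vecMul]
    by_cases hij' : i = j
    · rw [← hij', ri, h3 hij', smul_vecMul, vecMul_inv_of_eq hc ri]
    · rw [rk j (Ne.symm hij'), (h4 hij').1, vecMul_inv_of_eq hc ri, hij hij', one_smul]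

/-- If `T e_i` is not a multiple of `e_i`, where `i` is the least index outside `S`, and `j` is the
highest index occurring in `T e_i`, then making `T e_i` the `j`-th basis vector is an upper
triangular change of basis, after which `T` exchanges `e_i` and `e_j`. -/
theorem NormalOn.exists_exchange {T : Matrix (Fin n) (Fin n) K} (hT : T * T = 1)
    {S : Finset (Fin n)} (h : NormalOn T S)
    {i : Fin n} (hi : ∀ k < i, k ∈ S) (hiS : i ∉ S)
    (hne : ∀ a : K, T *ᵥ Pi.single i 1 ≠ a • Pi.single i 1) :
    ∃ b : Matrix (Fin n) (Fin n) K, BlockTriangular b id ∧ IsUnit b.det ∧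
      NormalOn (b⁻¹ * T * b) S ∧ ∃ j, j ∉ S ∧ i ≠ j ∧
      (b⁻¹ * T * b) *ᵥ Pi.single i 1 = Pi.single j 1 ∧
      (b⁻¹ * T * b) *ᵥ Pi.single j 1 = Pi.single i 1 := by
  set u := T *ᵥ Pi.single i 1 with hu
  have hTu : T *ᵥ u = Pi.single i 1 := by rw [hu, mulVec_mulVec, hT, one_mulVec]
  have hu0 : u ≠ 0 := fun h0 => hne 0 (by rw [h0, zero_smul])
  have huS : ∀ s ∈ S, u s = 0 := fun s hs => by
    simpa [hu] using (h.apply_eq_zero hs hiS).2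
  obtain ⟨k, hk⟩ := Function.ne_iff.1 hu0
  obtain ⟨j, hj, hmax⟩ := (Finset.univ.filter fun k => u k ≠ 0).exists_maximal
    ⟨k, by simpa using hk⟩
  have hj0 : u j ≠ 0 := by simpa using hj
  have htop : ∀ k, j < k → u k = 0 := by
    intro k hjk
    by_contra hk0
    exact absurd (hmax (by simpa using hk0) hjk.le) (not_le.2 hjk)
  have hjS : j ∉ S := fun h' => hj0 (huS j h')
  have hij : i ≠ j := by
    rintro rfl
    apply hne (u i)
    ext k
    rcases lt_trichotomy k i with hk | rfl | hk
    · simp [huS k (hi k hk), hk.ne]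
    · simp
    · simp [htop k hk, hk.ne']
  set b := updateCol (1 : Matrix (Fin n) (Fin n) K) j u with hb
  have bj : b *ᵥ Pi.single j 1 = u := by
    ext m; simp [hb]
  have bk : ∀ k, k ≠ j → b *ᵥ Pi.single k 1 = Pi.single k 1 := by
    intro k hk; ext m; simp [hb, hk, one_apply, Pi.single_apply]
  have rs : ∀ s ∈ S, Pi.single s 1 ᵥ* b = Pi.single s 1 := by
    intro s hs; ext m
    by_cases hm : m = j
    · have : m ≠ s := by rintro rfl; exact hjS (hm ▸ hs)
      subst hm
      simp [hb, huS s hs, this]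
    · simp [hb, hm, one_apply, Pi.single_apply, eq_comm]
  have ht : BlockTriangular b id := by
    intro x y (hxy : y < x)
    by_cases hy : y = j
    · subst hy; simpa [hb] using htop x hxy
    · simp [hb, hy, one_apply, hxy.ne']
  have hd : IsUnit b.det := by
    rw [det_of_isUpperTriangular ht, isUnit_iff_ne_zero, Finset.prod_ne_zero_iff]
    intro a _
    by_cases ha : a = j
    · subst ha; simpa [hb] using hj0
    · simp [hb, ha]
  refine ⟨b, ht, hd, h.conj hd (fun s hs => bk s ?_) rs, j, hjS, hij, ?_, ?_⟩
  · rintro rfl; exact hjS hs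
  · rw [← mulVec_mulVec, ← mulVec_mulVec, bk i hij, ← hu, inv_mulVec_of_eq hd bj]
  · rw [← mulVec_mulVec, ← mulVec_mulVec, bj, hTu, inv_mulVec_of_eq hd (bk i hij)]

theorem conj_mul_self {T b : Matrix (Fin n) (Fin n) K} (hT : T * T = 1) (hb : IsUnit b.det) :
    (b⁻¹ * T * b) * (b⁻¹ * T * b) = 1 := by
  calc (b⁻¹ * T * b) * (b⁻¹ * T * b) = b⁻¹ * T * (b * b⁻¹) * T * b := by
        simp only [Matrix.mul_assoc]
    _ = b⁻¹ * (T * T) * b := by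
        rw [mul_nonsing_inv b hb, Matrix.mul_one]; simp only [Matrix.mul_assoc]
    _ = 1 := by rw [hT, Matrix.mul_one, nonsing_inv_mul b hb]

theorem exists_conj_normalOn_insert [NeZero (2 : K)] {T : Matrix (Fin n) (Fin n) K}
    (hT : T * T = 1) {S : Finset (Fin n)} (h : NormalOn T S)
    {i : Fin n} (hi : ∀ k < i, k ∈ S) (hiS : i ∉ S) :
    ∃ b : Matrix (Fin n) (Fin n) K, BlockTriangular b id ∧ IsUnit b.det ∧
      ∃ j, NormalOn (b⁻¹ * T * b) (insert i (insert j S)) := by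
  have h2 : (2 : K) ≠ 0 := NeZero.ne 2
  by_cases hne : ∀ a : K, T *ᵥ Pi.single i 1 ≠ a • Pi.single i 1
  · obtain ⟨b, hb, hd, hN, j, hjS, hij, h1, h1'⟩ := h.exists_exchange hT hi hiS hne
    have hT' := conj_mul_self hT hd
    set T' := b⁻¹ * T * b with hTdef
    obtain ⟨b', hb', hd', hN'⟩ := hN.extend hi hiS (ε := 1) (φ := Pi.single j 1 ᵥ* T')
      (Or.inl rfl) (fun _ => rfl) (by rw [h1, one_smul]) (by rw [h1', one_smul])
      (fun s hs => by simpa using (hN.apply_eq_zero hs hjS).1)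
      (by simpa using congrFun h1 j)
      (fun hij => by simpa [hij.symm] using congrFun h1' j)
      (fun h => absurd h hij)
      (fun _ => ⟨rfl, by rw [vecMul_vecMul, hT', vecMul_one]⟩)
    refine ⟨b * b', hb.mul hb', by rw [det_mul]; exact hd.mul hd', j, ?_⟩
    convert hN' using 1
    rw [hTdef, Matrix.mul_inv_rev]
    simp only [Matrix.mul_assoc]
  · push Not at hne
    obtain ⟨a, ha⟩ := hne
    have haa : a * a = 1 := by
      have := congrArg (T *ᵥ ·) ha
      simp only [mulVec_mulVec, hT, one_mulVec, mulVec_smul] at this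
      rw [ha, smul_smul] at this
      simpa using (congrFun this i).symm
    have hTii : T i i = a := by simpa using congrFun ha i
    -- averaging the `i`-th dual basis vector over `T` gives a dual eigenvector with eigenvalue `a`
    obtain ⟨b, hb, hd, hN⟩ := h.extend hi hiS (ε := a)
      (φ := (2 : K)⁻¹ • (Pi.single i 1 + a • (Pi.single i 1 ᵥ* T)))
      (mul_self_eq_one_iff.1 haa) (fun h => absurd rfl h) ha ha
      (fun s hs => by
        have : s ≠ i := by rintro rfl; exact hiS hs
        simp [this, (h.apply_eq_zero hs hiS).1])
      (by
        simp [hTii, haa, one_add_one_eq_two, h2])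
      (fun h => absurd rfl h)
      (fun _ => by
        rw [smul_vecMul, add_vecMul, smul_vecMul, vecMul_vecMul, hT, vecMul_one]
        ext m
        simp only [Pi.smul_apply, Pi.add_apply, smul_eq_mul]
        linear_combination (-(2 : K)⁻¹ * (Pi.single i 1 ᵥ* T) m) * haa)
      (fun h => absurd rfl h)
    exact ⟨b, hb, hd, i, hN⟩

/-- Every matrix `T` with `T * T = 1` is conjugate under the upper triangular group to a signed
involution of the standard basis. -/
theorem exists_conj_normalOn_univ [NeZero (2 : K)] {T : Matrix (Fin n) (Fin n) K}
    (hT : T * T = 1) :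
    ∃ b : Matrix (Fin n) (Fin n) K, BlockTriangular b id ∧ IsUnit b.det ∧
      NormalOn (b⁻¹ * T * b) Finset.univ := by
  suffices H : ∀ (m : ℕ) (S : Finset (Fin n)) (T : Matrix (Fin n) (Fin n) K), Sᶜ.card = m →
      T * T = 1 → NormalOn T S →
      ∃ b : Matrix (Fin n) (Fin n) K, BlockTriangular b id ∧ IsUnit b.det ∧
        NormalOn (b⁻¹ * T * b) Finset.univ from
    H _ ∅ T rfl hT (by intro j hj; simp at hj)
  intro m
  induction m using Nat.strong_induction_on with
  | _ m ih =>
    intro S T hm hT hN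
    by_cases hS : S = Finset.univ
    · subst hS
      exact ⟨1, blockTriangular_one, by simp, by simpa using hN⟩
    · have hne : Sᶜ.Nonempty := by
        rw [Finset.nonempty_iff_ne_empty]; simpa using hS
      have hiS : Sᶜ.min' hne ∉ S := Finset.mem_compl.1 (Sᶜ.min'_mem hne)
      have hi : ∀ k < Sᶜ.min' hne, k ∈ S := by
        intro k hk
        by_contra hkS
        exact absurd (Sᶜ.min'_le k (Finset.mem_compl.2 hkS)) (not_le.2 hk)
      obtain ⟨b, hb, hd, j, hN'⟩ := exists_conj_normalOn_insert hT hN hi hiS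
      obtain ⟨b', hb', hd', hN''⟩ := ih _ (by
        rw [← hm]
        apply Finset.card_lt_card
        rw [Finset.compl_ssubset_compl]
        refine Finset.ssubset_iff_subset_ne.2 ⟨fun x hx => by simp [hx], fun h => hiS ?_⟩
        have := Finset.mem_insert_self (Sᶜ.min' hne) (insert j S)
        rwa [← h] at this) _ _ rfl (conj_mul_self hT hd) hN'
      refine ⟨b * b', hb.mul hb', by rw [det_mul]; exact hd.mul hd', ?_⟩
      convert hN'' using 1
      rw [Matrix.mul_inv_rev]
      simp only [Matrix.mul_assoc]

end NormalForm

/-! ### Clans as signed involutions -/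

namespace PreClan

variable {p q : ℕ}

theorem mate_eq_iff_match {c : PreClan p q} {i j : Fin (p + q)} (hij : i ≠ j) :
    c.mate i = j ↔ c.Match i j := by
  constructor
  · intro h
    by_cases hm : ∃ j, c.Match i j
    · obtain ⟨k, hk⟩ := hm
      rw [match_mate hk] at h
      rwa [← h]
    · rw [mate_eq_self hm] at h
      exact absurd h hij
  · exact match_mate

theorem mate_eq_self_iff {c : PreClan p q} {i : Fin (p + q)} :
    c.mate i = i ↔ c.symbol i = .plus ∨ c.symbol i = .minus := by
  constructor
  · intro h
    by_contra h'
    push Not at h'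
    obtain ⟨j, hj⟩ := exists_match h'.1 h'.2
    rw [match_mate hj] at h
    exact hj.1 h.symm
  · intro h
    refine mate_eq_self ?_
    rintro ⟨j, hj⟩
    exact h.elim hj.2.2.1 hj.2.2.2

theorem pos_iff_of_match {c : PreClan p q} {i j : Fin (p + q)} (h : c.Match i j) :
    c.Pos i ↔ j < i := by
  constructor
  · rintro (h' | ⟨k, hk, hk'⟩)
    · exact absurd h' h.2.2.1
    · rwa [h.unique hk']
  · exact fun h' => Or.inr ⟨j, h', h⟩

theorem pos_mate_iff {c : PreClan p q} {i : Fin (p + q)} (h : c.mate i ≠ i) :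
    c.Pos (c.mate i) ↔ ¬ c.Pos i := by
  have hm : c.Match i (c.mate i) := (mate_eq_iff_match h.symm).1 rfl
  rw [pos_iff_of_match hm, pos_iff_of_match hm.symm, not_lt]
  exact ⟨le_of_lt, fun h' => lt_of_le_of_ne h' h.symm⟩

theorem pos_of_plus {c : PreClan p q} {i : Fin (p + q)} (h : c.symbol i = .plus) : c.Pos i :=
  Or.inl h

theorem not_pos_of_minus {c : PreClan p q} {i : Fin (p + q)} (h : c.symbol i = .minus) :
    ¬ c.Pos i := by
  rintro (h' | ⟨j, -, hj⟩)
  · simp [h] at h'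
  · exact hj.2.2.2 h

/-- The clan of a string is determined by its matching and the positions of the signs `-`. -/
theorem equiv_of_mate_eq {c d : PreClan p q} (h : c.mate = d.mate)
    (hm : ∀ i, c.symbol i = .minus ↔ d.symbol i = .minus) : c ≈ d := by
  have plus_iff : ∀ (c : PreClan p q) i,
      c.symbol i = .plus ↔ c.mate i = i ∧ c.symbol i ≠ .minus := by
    intro c i
    rw [mate_eq_self_iff]
    constructor
    · intro h; simp [h]
    · rintro ⟨h | h, h'⟩
      · exact h
      · exact absurd h h'
  have hp : ∀ i, c.symbol i = .plus ↔ d.symbol i = .plus := by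
    intro i; rw [plus_iff, plus_iff, h, Ne, Ne, hm]
  have eq_iff : ∀ (c : PreClan p q) i j, c.symbol i = c.symbol j ↔
      i = j ∨ (c.symbol i = .plus ∧ c.symbol j = .plus) ∨
        (c.symbol i = .minus ∧ c.symbol j = .minus) ∨ (i ≠ j ∧ c.mate i = j) := by
    intro c i j
    by_cases hij : i = j
    · simp [hij]
    · simp only [hij, false_or, ne_eq, not_false_eq_true, true_and, mate_eq_iff_match hij]
      constructor
      · intro h
        by_cases h1 : c.symbol i = .plus
        · exact Or.inl ⟨h1, h ▸ h1⟩
        by_cases h2 : c.symbol i = .minus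
        · exact Or.inr (Or.inl ⟨h2, h ▸ h2⟩)
        exact Or.inr (Or.inr ⟨hij, h, h1, h2⟩)
      · rintro (⟨h1, h2⟩ | ⟨h1, h2⟩ | h)
        · rw [h1, h2]
        · rw [h1, h2]
        · exact h.2.1
  refine ⟨hp, hm, fun i j => ?_⟩
  rw [eq_iff, eq_iff, h]
  simp only [hp, hm]

/-- The eigenvalue sign of a position: `-1` at the symbols `-` and `1` elsewhere. -/
def sign (c : PreClan p q) (i : Fin (p + q)) : ℂ := if c.symbol i = .minus then -1 else 1

/-- The signed involution matrix of a string: it multiplies `e_i` by `±1` if `c_i = ±` and exchanges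
`e_i` and `e_j` if `c_i = c_j` is a number. -/
def involution (c : PreClan p q) : Matrix (Fin (p + q)) (Fin (p + q)) ℂ :=
  Matrix.of fun k i => if k = c.mate i then c.sign i else 0

theorem sign_ne_zero (c : PreClan p q) (i : Fin (p + q)) : c.sign i ≠ 0 := by
  rw [sign]; split_ifs <;> simp

theorem sign_mate (c : PreClan p q) (i : Fin (p + q)) : c.sign (c.mate i) = c.sign i := by
  by_cases h : c.mate i = i
  · rw [h]
  · have h1 : c.symbol i ≠ .minus := fun h' => h (mate_eq_self_iff.2 (Or.inr h'))
    have h2 : c.symbol (c.mate i) ≠ .minus := fun h' => h (by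
      have := mate_eq_self_iff.2 (Or.inr h')
      rw [mate_mate] at this
      exact this.symm)
    simp [sign, h1, h2]

theorem mul_involution_apply (c : PreClan p q) (A : Matrix (Fin (p + q)) (Fin (p + q)) ℂ)
    (k i : Fin (p + q)) : (A * c.involution) k i = A k (c.mate i) * c.sign i := by
  simp [Matrix.mul_apply, involution]

theorem involution_apply_mate (c : PreClan p q) (k i : Fin (p + q)) :
    c.involution k i = if i = c.mate k then c.sign k else 0 := by
  have : k = c.mate i ↔ i = c.mate k :=
    ⟨fun h => by rw [h, mate_mate], fun h => by rw [h, mate_mate]⟩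
  simp only [involution, Matrix.of_apply, this]
  split_ifs with h
  · rw [h, sign_mate]
  · rfl

theorem involution_mul_apply (c : PreClan p q) (A : Matrix (Fin (p + q)) (Fin (p + q)) ℂ)
    (k i : Fin (p + q)) : (c.involution * A) k i = c.sign k * A (c.mate k) i := by
  simp [Matrix.mul_apply, involution_apply_mate]

theorem involution_mulVec_apply (c : PreClan p q) (x : Fin (p + q) → ℂ) (k : Fin (p + q)) :
    (c.involution *ᵥ x) k = c.sign k * x (c.mate k) := by
  simp [Matrix.mulVec, dotProduct, involution_apply_mate]

end PreClan

theorem perm_eq_id_of_le {n : ℕ} {f : Fin n → Fin n} (hf : Function.Injective f)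
    (h : ∀ i, f i ≤ i) : ∀ i, f i = i := by
  intro i
  induction i using WellFoundedLT.induction with
  | _ i ih =>
    by_contra hne
    exact hne (hf (ih (f i) (lt_of_le_of_ne (h i) hne)))

namespace PreClan

variable {p q : ℕ}

/-- Two signed involutions that are conjugate under the upper triangular group are equal: comparing
the entries of `a T_d = T_c a` at the positions `(d.mate i, i)` shows that the permutation
`c.mate ∘ d.mate` never increases an index. -/
theorem equiv_of_conj {c d : PreClan p q} {a : Matrix (Fin (p + q)) (Fin (p + q)) ℂ}
    (ha : ∀ i j, j < i → a i j = 0) (hd : ∀ i, a i i ≠ 0)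
    (h : a * d.involution = c.involution * a) : c ≈ d := by
  have key : ∀ k i, a k (d.mate i) * d.sign i = c.sign k * a (c.mate k) i := by
    intro k i
    rw [← mul_involution_apply, ← involution_mul_apply, h]
  have hle : ∀ i, c.mate (d.mate i) ≤ i := by
    intro i
    by_contra hlt
    have := key (d.mate i) i
    rw [ha _ _ (not_le.1 hlt), mul_zero] at this
    exact mul_ne_zero (hd _) (d.sign_ne_zero i) this
  have hinj : Function.Injective fun i => c.mate (d.mate i) :=
    (Function.Involutive.injective c.mate_mate).comp (Function.Involutive.injective d.mate_mate)
  have hid := perm_eq_id_of_le hinj hle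
  have hmate : c.mate = d.mate := by
    funext i
    have := hid (d.mate i)
    rwa [mate_mate] at this
  refine equiv_of_mate_eq hmate fun i => ?_
  have hs : ∀ i, d.sign i = c.sign i := by
    intro i
    have := key (d.mate i) i
    rw [hid i, mul_comm] at this
    have e : a (d.mate i) (d.mate i) * d.sign i = c.sign (d.mate i) * a i i := by
      rw [mul_comm, this]
    by_cases hi : d.mate i = i
    · rw [hi, mul_comm] at e
      exact mul_right_cancel₀ (hd i) e
    · have h1 : d.symbol i ≠ .minus := fun h' => hi (mate_eq_self_iff.2 (Or.inr h'))
      have h2 : c.symbol i ≠ .minus := fun h' => hi (by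
        rw [← hmate]; exact mate_eq_self_iff.2 (Or.inr h'))
      simp [sign, h1, h2]
  have := hs i
  simp only [sign] at this
  by_cases h1 : c.symbol i = .minus <;> by_cases h2 : d.symbol i = .minus <;>
    simp only [h1, h2, if_true, if_false] at this ⊢ <;> norm_num at this

/-- A signed involution of the basis with trace `p - q` is the matrix of a clan. -/
theorem exists_involution_eq {N : Matrix (Fin (p + q)) (Fin (p + q)) ℂ}
    (hN : NormalOn N Finset.univ) (htr : N.trace = (p : ℂ) - q) :
    ∃ c : PreClan p q, c.involution = N := by
  choose w _ ε hε hwε hcol hrow using fun j => hN j (Finset.mem_univ j)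
  have hc : ∀ k j, N k j = if k = w j then ε j else 0 := fun k j => by
    simpa [Pi.single_apply] using congrFun (hcol j) k
  have hr : ∀ j k, N j k = if k = w j then ε j else 0 := fun j k => by
    simpa [Pi.single_apply] using congrFun (hrow j) k
  have hε0 : ∀ j, ε j ≠ 0 := fun j => by rcases hε j with h | h <;> simp [h]
  have hw : ∀ j, w (w j) = j := by
    intro j
    by_contra hne
    have h1 := hc (w j) j
    rw [hr, if_neg (Ne.symm hne), if_pos rfl] at h1
    exact hε0 j h1.symm
  have hneg : (-1 : ℂ) ≠ 1 := by norm_num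
  -- the two positions of a pair carry the smaller of them as their common number
  set s : Fin (p + q) → ClanSymbol := fun i =>
    if w i = i then (if ε i = 1 then .plus else .minus) else .num (min (i : ℕ) (w i)) with hs
  have s_num : ∀ i, w i ≠ i → s i = .num (min (i : ℕ) (w i)) := fun i h => by
    simp [hs, h]
  have s_plus : ∀ i, s i = .plus ↔ w i = i ∧ ε i = 1 := fun i => by
    simp only [hs]; split_ifs with h1 h2 <;> simp [*]
  have s_minus : ∀ i, s i = .minus ↔ w i = i ∧ ε i = -1 := fun i => by
    simp only [hs]
    split_ifs with h1 h2
    · simp [h2, hneg.symm]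
    · simp [h1, (hε i).resolve_left h2]
    · simp [h1]
  have s_pair : ∀ i, w i ≠ i → s (w i) = s i := fun i h => by
    rw [s_num i h, s_num (w i) (by rw [hw]; exact h.symm), hw, min_comm]
  let c : PreClan p q :=
    { symbol := s
      paired := by
        intro i k hk
        have hi : w i ≠ i := by
          intro h
          simp only [hs, h, if_true] at hk
          split_ifs at hk
        refine ⟨w i, ⟨hi, s_pair i hi⟩, ?_⟩
        rintro j ⟨hji, hj⟩
        have hwj : w j ≠ j := by
          intro h
          rw [s_num i hi] at hj
          simp only [hs, h, if_true] at hj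
          split_ifs at hj
        rw [s_num i hi, s_num j hwj, ClanSymbol.num.injEq] at hj
        have hji' : (j : ℕ) ≠ i := fun h => hji (Fin.ext h)
        have hwij : (w j : ℕ) ≠ w i := fun h => hji (by
          rw [← hw j, Fin.ext h, hw])
        have hor : (j : ℕ) = w i ∨ (w j : ℕ) = i := by omega
        rcases hor with h | h
        · exact Fin.ext h
        · rw [← hw j, Fin.ext h]
      count := by
        have h1 : N.trace = ∑ i, ((if s i = .plus then (1 : ℂ) else 0)
            - (if s i = .minus then (1 : ℂ) else 0)) := by
          rw [Matrix.trace]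
          refine Finset.sum_congr rfl fun i _ => ?_
          rw [Matrix.diag_apply, hc]
          simp only [s_plus, s_minus, eq_comm (a := i) (b := w i)]
          by_cases hi : w i = i
          · rcases hε i with h | h <;> simp [hi, h, hneg, hneg.symm]
          · simp [hi]
        rw [htr, Finset.sum_sub_distrib, Finset.sum_boole, Finset.sum_boole] at h1
        exact_mod_cast h1.symm }
  have hmate : ∀ i, c.mate i = w i := by
    intro i
    by_cases h : w i = i
    · rw [h, mate_eq_self_iff]
      rcases hε i with h' | h'
      · exact Or.inl ((s_plus i).2 ⟨h, h'⟩)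
      · exact Or.inr ((s_minus i).2 ⟨h, h'⟩)
    · refine match_mate ⟨Ne.symm h, (s_pair i h).symm, ?_, ?_⟩
      · exact fun h' => h ((s_plus i).1 h').1
      · exact fun h' => h ((s_minus i).1 h').1
  refine ⟨c, ?_⟩
  ext k i
  rw [hc]
  simp only [involution, Matrix.of_apply, hmate]
  have : c.sign i = ε i := by
    have e : c.symbol i = .minus ↔ w i = i ∧ ε i = -1 := s_minus i
    simp only [sign, e]
    rcases hε i with h | h
    · simp [h, hneg.symm]
    · have : w i = i := by
        by_contra h'
        exact hneg (h.symm.trans (hwε i h'))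
      simp [h, this]
  rw [this]

end PreClan

/-! ### The default matrices diagonalize the signed involutions -/

/-- The diagonal involution whose eigenspaces for `1` and `-1` are spanned by the first `p` and the
last `q` basis vectors; its centralizer in `SL_n` is the Levi subgroup. -/
def blockSign (p q : ℕ) : Matrix (Fin (p + q)) (Fin (p + q)) ℂ :=
  Matrix.diagonal fun i => if (i : ℕ) < p then 1 else -1

theorem mem_levi_iff {p q : ℕ} {g : SLn p q} :
    g ∈ levi p q ↔ (g : Matrix (Fin (p + q)) (Fin (p + q)) ℂ) * blockSign p q
      = blockSign p q * (g : Matrix (Fin (p + q)) (Fin (p + q)) ℂ) := by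
  have hL : g ∈ levi p q ↔ ∀ i j : Fin (p + q), ¬ ((i : ℕ) < p ↔ (j : ℕ) < p) → g i j = 0 := by
    constructor
    · rintro ⟨h1, h2⟩ i j hij
      by_cases hi : (i : ℕ) < p <;> by_cases hj : (j : ℕ) < p
      · simp [hi, hj] at hij
      · exact h2 i j (by simp [hi, hj])
      · exact h1 i j (by simp [hi, hj])
      · simp [hi, hj] at hij
    · intro h
      refine ⟨fun i j hij => h i j ?_, fun i j hij => h i j ?_⟩ <;>
      · intro h'
        simp [h'] at hij
  rw [hL, ← Matrix.ext_iff]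
  refine forall_congr' fun i => forall_congr' fun j => ?_
  simp only [blockSign, Matrix.mul_diagonal, Matrix.diagonal_mul]
  by_cases hi : (i : ℕ) < p <;> by_cases hj : (j : ℕ) < p <;>
    simp [hi, hj, eq_neg_iff_add_eq_zero, neg_eq_iff_add_eq_zero, ← two_mul]

theorem exchange_apply_cases {n : ℕ} {S T : Finset (Fin n)} (h : S.card = T.card) (i : Fin n) :
    (i ∈ S ∧ exchange S T h i ∈ T) ∨ (i ∉ S ∧ i ∈ T ∧ exchange S T h i ∈ S) ∨
      (i ∉ S ∧ i ∉ T ∧ exchange S T h i = i) := by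
  by_cases hS : i ∈ S
  · refine Or.inl ⟨hS, ?_⟩
    rw [exchange, dif_pos hS]
    exact Finset.orderEmbOfFin_mem _ _ _
  · by_cases hT : i ∈ T
    · refine Or.inr (Or.inl ⟨hS, hT, ?_⟩)
      rw [exchange, dif_neg hS, dif_pos hT]
      exact Finset.orderEmbOfFin_mem _ _ _
    · exact Or.inr (Or.inr ⟨hS, hT, by simp [exchange, hS, hT]⟩)

namespace PreClan

variable {p q : ℕ}

/-- The default permutation moves the positions of signature `+` to the first `p` places. -/
theorem defaultPerm_lt_iff (c : PreClan p q) (i : Fin (p + q)) :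
    (c.defaultPerm i : ℕ) < p ↔ c.Pos i := by
  have h := exchange_apply_cases c.card_setS i
  change (exchange c.setS c.setT c.card_setS i : ℕ) < p ↔ c.Pos i
  have hS : ∀ j, j ∈ c.setS ↔ (j : ℕ) < p ∧ ¬ c.Pos j := fun j => by simp [setS]
  have hT : ∀ j, j ∈ c.setT ↔ ¬ (j : ℕ) < p ∧ c.Pos j := fun j => by simp [setT]
  rw [hS, hT, hT, hS] at h
  rcases h with ⟨h1, h2⟩ | ⟨-, h1, h2⟩ | ⟨h1, h2, h3⟩
  · exact iff_of_false h2.1 h1.2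
  · exact iff_of_true h2.1 h1.2
  · rw [h3]
    by_cases hi : (i : ℕ) < p <;> by_cases hc : c.Pos i <;> simp_all

theorem flagMatrix_mul_involution (c : PreClan p q) :
    c.flagMatrix * c.involution = blockSign p q * c.flagMatrix := by
  have hJ : ∀ k i : Fin (p + q), (if (k : ℕ) < p then (1 : ℂ) else -1) *
      (Pi.single (c.defaultPerm i) (1 : ℂ) : Fin (p + q) → ℂ) k
      = (if c.Pos i then 1 else -1) *
        (Pi.single (c.defaultPerm i) (1 : ℂ) : Fin (p + q) → ℂ) k := by
    intro k i
    by_cases hk : k = c.defaultPerm i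
    · subst hk; simp only [defaultPerm_lt_iff]
    · simp [hk]
  ext k i
  rw [mul_involution_apply, blockSign, Matrix.diagonal_mul]
  simp only [flagMatrix, Matrix.of_apply, flagVector, sign]
  by_cases h : c.mate i = i
  · have h' := mate_eq_self_iff.1 h
    simp only [h, if_pos h', hJ]
    rcases h' with h' | h'
    · simp [h', pos_of_plus h']
    · simp [h', not_pos_of_minus h']
  · have h1 : ¬ (c.symbol i = .plus ∨ c.symbol i = .minus) := fun h' => h (mate_eq_self_iff.2 h')
    have h2 : ¬ (c.symbol (c.mate i) = .plus ∨ c.symbol (c.mate i) = .minus) := fun h' => by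
      have := mate_eq_self_iff.2 h'
      rw [mate_mate] at this
      exact h this.symm
    have h3 : c.symbol i ≠ .minus := fun h' => h1 (Or.inr h')
    rw [if_neg h1, if_neg h2, if_neg h3, mate_mate]
    by_cases hp : c.Pos i
    · have hp' : ¬ c.Pos (c.mate i) := fun h' => (pos_mate_iff h).1 h' hp
      simp only [hp, hp', if_true, if_false, Pi.add_apply, Pi.neg_apply, mul_add, hJ]
      ring
    · have hp' : c.Pos (c.mate i) := (pos_mate_iff h).2 hp
      simp only [hp, hp', if_true, if_false, Pi.add_apply, Pi.neg_apply, mul_add, mul_neg, hJ]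
      ring

end PreClan

/-! ### Borel orbits in `SL_n / L` -/

section Orbits

variable {p q : ℕ}

theorem SLn.val_mul (g h : SLn p q) : (g * h).1 = g.1 * h.1 := rfl

theorem SLn.inv_val_mul (g : SLn p q) : (g⁻¹).1 * g.1 = 1 := by
  have h : (g⁻¹ * g).1 = 1 := by rw [inv_mul_cancel]; rfl
  exact h

theorem SLn.val_mul_inv (g : SLn p q) : g.1 * (g⁻¹).1 = 1 := by
  have h : (g * g⁻¹).1 = 1 := by rw [mul_inv_cancel]; rfl
  exact h

/-- If `g` conjugates `T` to `blockSign p q`, then `h L` lies in the Borel orbit of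
`g⁻¹ L` if and only if `h⁻¹ b` conjugates `T` to `blockSign p q` for some `b` in the Borel
subgroup. -/
theorem mem_orbit_inv_iff {T : Matrix (Fin (p + q)) (Fin (p + q)) ℂ} {g : SLn p q}
    (hg : (g : Matrix (Fin (p + q)) (Fin (p + q)) ℂ) * T = blockSign p q * g.1) (h : SLn p q) :
    (h : SLn p q ⧸ levi p q) ∈
        MulAction.orbit (borelSubgroup p q) ((g⁻¹ : SLn p q) : SLn p q ⧸ levi p q) ↔
      ∃ b ∈ borelSubgroup p q,
        (h⁻¹ * b : SLn p q).1 * T = blockSign p q * (h⁻¹ * b : SLn p q).1 := by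
  have hgg := g.val_mul_inv
  have key : ∀ b : SLn p q,
      (((b * g⁻¹ : SLn p q) : SLn p q ⧸ levi p q) = (h : SLn p q ⧸ levi p q)) ↔
      (h⁻¹ * b : SLn p q).1 * T = blockSign p q * (h⁻¹ * b : SLn p q).1 := by
    intro b
    rw [eq_comm, QuotientGroup.eq, mem_levi_iff, ← mul_assoc]
    set x := h⁻¹ * b * g⁻¹ with hx
    have hy : h⁻¹ * b = x * g := by rw [hx]; group
    rw [hy, SLn.val_mul x g, Matrix.mul_assoc, hg, ← Matrix.mul_assoc,
      ← Matrix.mul_assoc]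
    constructor
    · intro h; rw [h]
    · intro h
      have := congrArg (· * (g⁻¹ : SLn p q).1) h
      simpa only [Matrix.mul_assoc, hgg, Matrix.mul_one] using this
  constructor
  · rintro ⟨b, hb⟩
    exact ⟨b, b.2, (key b).1 hb⟩
  · rintro ⟨b, hb, h'⟩
    exact ⟨⟨b, hb⟩, (key b).2 h'⟩

theorem Clan.IsDefaultMatrix.mul_involution {c : PreClan p q} {g : SLn p q}
    (hg : Clan.IsDefaultMatrix (Quotient.mk _ c) g) :
    (g : Matrix (Fin (p + q)) (Fin (p + q)) ℂ) * c.involution = blockSign p q * g.1 := by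
  obtain ⟨ζ, -, hζ⟩ := hg
  change g.1 = ζ • c.flagMatrix at hζ
  rw [hζ, Matrix.smul_mul, c.flagMatrix_mul_involution, Matrix.mul_smul]

theorem mem_borelOrbit_iff (c : PreClan p q) (h : SLn p q) :
    (h : SLn p q ⧸ levi p q) ∈ Clan.borelOrbit (Quotient.mk _ c) ↔
      ∃ b ∈ borelSubgroup p q, (h⁻¹ * b : SLn p q).1 * c.involution
        = blockSign p q * (h⁻¹ * b : SLn p q).1 :=
  mem_orbit_inv_iff (Clan.IsDefaultMatrix.mul_involution
    (Clan.exists_isDefaultMatrix (Quotient.mk _ c)).choose_spec) h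

theorem borelOrbit_eq_of_isDefaultMatrix (γ : Clan p q) (g : SLn p q) (hg : γ.IsDefaultMatrix g) :
    γ.borelOrbit =
      MulAction.orbit (borelSubgroup p q) ((g⁻¹ : SLn p q) : SLn p q ⧸ levi p q) := by
  induction γ using Quotient.inductionOn with
  | h c =>
    ext x
    induction x using QuotientGroup.induction_on with
    | H h => rw [mem_borelOrbit_iff, mem_orbit_inv_iff hg.mul_involution]

theorem diag_ne_zero_of_mem_borel {a : SLn p q} (ha : a ∈ borelSubgroup p q) (i : Fin (p + q)) :
    a i i ≠ 0 := by
  have ht : a.1.BlockTriangular id := fun i j h => ha i j h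
  have hd : ∏ i, a.1 i i = 1 := (det_of_isUpperTriangular ht).symm.trans a.2
  intro h0
  exact one_ne_zero (hd.symm.trans (Finset.prod_eq_zero (Finset.mem_univ i) h0))

theorem eq_of_mem_borelOrbit {γ δ : Clan p q} {x : SLn p q ⧸ levi p q} (h1 : x ∈ γ.borelOrbit)
    (h2 : x ∈ δ.borelOrbit) : γ = δ := by
  induction γ using Quotient.inductionOn with
  | h c =>
  induction δ using Quotient.inductionOn with
  | h d =>
  induction x using QuotientGroup.induction_on with
  | H h =>
    obtain ⟨b, hb, e⟩ := (mem_borelOrbit_iff c h).1 h1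
    obtain ⟨b', hb', e'⟩ := (mem_borelOrbit_iff d h).1 h2
    have ha := mul_mem (inv_mem hb) hb'
    set a := b⁻¹ * b' with hadef
    set y := h⁻¹ * b with hydef
    have hy : h⁻¹ * b' = y * a := by rw [hadef, hydef]; group
    have hyy := y.inv_val_mul
    rw [hy, SLn.val_mul, ← Matrix.mul_assoc, ← e, Matrix.mul_assoc,
      Matrix.mul_assoc] at e'
    have := congrArg ((y⁻¹ : SLn p q).1 * ·) e'
    simp only [← Matrix.mul_assoc, hyy, Matrix.one_mul] at this
    exact Quotient.sound (PreClan.equiv_of_conj ha (diag_ne_zero_of_mem_borel ha) this)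

theorem blockSign_mul_self : blockSign p q * blockSign p q = 1 := by
  rw [blockSign, Matrix.diagonal_mul_diagonal, ← Matrix.diagonal_one]
  congr 1
  funext i
  split_ifs <;> simp

theorem trace_blockSign : (blockSign p q).trace = (p : ℂ) - q := by
  simp [blockSign, Matrix.trace_diagonal, Fin.sum_univ_add, sub_eq_add_neg]

/-- An invertible upper triangular matrix is a multiple of an element of the Borel subgroup. -/
theorem exists_smul_mem_borel {b : Matrix (Fin (p + q)) (Fin (p + q)) ℂ}
    (hb : b.BlockTriangular id) (hd : IsUnit b.det) :
    ∃ a ∈ borelSubgroup p q, ∃ ζ : ℂ, (a : Matrix (Fin (p + q)) (Fin (p + q)) ℂ) = ζ • b := by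
  obtain ⟨ζ, hζ⟩ : ∃ ζ : ℂ, ζ ^ (p + q) * b.det = 1 := by
    rcases Nat.eq_zero_or_pos (p + q) with h | h
    · have : IsEmpty (Fin (p + q)) := by rw [h]; infer_instance
      exact ⟨1, by simp [Matrix.det_isEmpty]⟩
    · obtain ⟨ζ, hζ⟩ := IsAlgClosed.exists_pow_nat_eq (b.det)⁻¹ h
      exact ⟨ζ, by rw [hζ, inv_mul_cancel₀ hd.ne_zero]⟩
  refine ⟨⟨ζ • b, by rw [Matrix.det_smul, Fintype.card_fin, hζ]⟩, ?_, ζ, rfl⟩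
  intro i j hij
  change ζ * b i j = 0
  rw [hb hij, mul_zero]

theorem exists_mem_borelOrbit (x : SLn p q ⧸ levi p q) : ∃ γ : Clan p q, x ∈ γ.borelOrbit := by
  induction x using QuotientGroup.induction_on with
  | H h =>
    have hh := h.inv_val_mul
    set T := h.1 * blockSign p q * (h⁻¹ : SLn p q).1 with hTdef
    have hT : T * T = 1 := by
      calc T * T = h.1 * blockSign p q * ((h⁻¹ : SLn p q).1 * h.1) * blockSign p q *
            (h⁻¹ : SLn p q).1 := by simp only [hTdef, Matrix.mul_assoc]
        _ = h.1 * (blockSign p q * blockSign p q) * (h⁻¹ : SLn p q).1 := by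
            rw [hh, Matrix.mul_one]; simp only [Matrix.mul_assoc]
        _ = 1 := by
            rw [blockSign_mul_self, Matrix.mul_one, h.val_mul_inv]
    obtain ⟨b, hb, hd, hN⟩ := exists_conj_normalOn_univ hT
    obtain ⟨c, hc⟩ := PreClan.exists_involution_eq hN (by
      rw [Matrix.trace_mul_cycle, Matrix.mul_nonsing_inv b hd, Matrix.one_mul, hTdef,
        Matrix.trace_mul_cycle, hh, Matrix.one_mul, trace_blockSign])
    obtain ⟨a, ha, ζ, haζ⟩ := exists_smul_mem_borel hb hd
    refine ⟨Quotient.mk _ c, (mem_borelOrbit_iff c h).2 ⟨a, ha, ?_⟩⟩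
    rw [SLn.val_mul, haζ, hc, Matrix.mul_smul, Matrix.smul_mul, Matrix.mul_smul]
    congr 1
    calc (h⁻¹ : SLn p q).1 * b * (b⁻¹ * T * b) = (h⁻¹ : SLn p q).1 * (b * b⁻¹) * T * b := by
          simp only [Matrix.mul_assoc]
      _ = ((h⁻¹ : SLn p q).1 * h.1) * blockSign p q * (h⁻¹ : SLn p q).1 * b := by
          rw [Matrix.mul_nonsing_inv b hd, Matrix.mul_one, hTdef]; simp only [Matrix.mul_assoc]
      _ = blockSign p q * ((h⁻¹ : SLn p q).1 * b) := by
          rw [hh, Matrix.one_mul, Matrix.mul_assoc]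

end Orbits

/-! ### Schubert cells -/

section Schubert

variable {p q : ℕ}

theorem SLn.inv_mulVec_mulVec (g : SLn p q) (x : Fin (p + q) → ℂ) :
    (g⁻¹ : SLn p q).1 *ᵥ (g.1 *ᵥ x) = x := by
  rw [mulVec_mulVec, g.inv_val_mul, one_mulVec]

theorem SLn.mulVec_inv_mulVec (g : SLn p q) (x : Fin (p + q) → ℂ) :
    g.1 *ᵥ ((g⁻¹ : SLn p q).1 *ᵥ x) = x := by
  rw [mulVec_mulVec, g.val_mul_inv, one_mulVec]

theorem mem_firstColumns_iff {g : SLn p q} {x : Fin (p + q) → ℂ} :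
    x ∈ firstColumns p q g ↔ ∀ k : Fin (p + q), ¬ (k : ℕ) < p → ((g⁻¹ : SLn p q).1 *ᵥ x) k = 0 := by
  constructor
  · intro hx k hk
    induction hx using Submodule.span_induction with
    | mem x hx =>
      obtain ⟨j, hj, rfl⟩ := hx
      have : (fun i => g i j) = g.1 *ᵥ Pi.single j 1 := by ext i; simp
      rw [this, SLn.inv_mulVec_mulVec]
      have : k ≠ j := by rintro rfl; exact hk hj
      simp [this]
    | zero => simp
    | add x y _ _ hx hy => rw [mulVec_add, Pi.add_apply, hx, hy, add_zero]
    | smul a x _ hx => rw [mulVec_smul, Pi.smul_apply, hx, smul_zero]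
  · intro h
    have : x = ∑ k, ((g⁻¹ : SLn p q).1 *ᵥ x) k • (fun i => g i k) := by
      conv_lhs => rw [← SLn.mulVec_inv_mulVec g x]
      ext i
      simp [mulVec, dotProduct, mul_comm]
    rw [this]
    refine Submodule.sum_mem _ fun k _ => ?_
    by_cases hk : (k : ℕ) < p
    · exact Submodule.smul_mem _ _ (Submodule.subset_span ⟨k, hk, rfl⟩)
    · rw [h k hk, zero_smul]
      exact Submodule.zero_mem _

theorem mem_map_mulVecLin_iff {g : SLn p q} {W : Submodule ℂ (Fin (p + q) → ℂ)}
    {x : Fin (p + q) → ℂ} : x ∈ W.map g.1.mulVecLin ↔ (g⁻¹ : SLn p q).1 *ᵥ x ∈ W := by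
  constructor
  · rintro ⟨y, hy, rfl⟩
    rwa [mulVecLin_apply, SLn.inv_mulVec_mulVec]
  · intro h
    exact ⟨_, h, by rw [mulVecLin_apply, SLn.mulVec_inv_mulVec]⟩

theorem mem_coordPlane_iff {I : PSubset p q} {x : Fin (p + q) → ℂ} :
    x ∈ coordPlane I ↔ ∀ k ∉ I.1, x k = 0 := by
  constructor
  · intro hx k hk
    induction hx using Submodule.span_induction with
    | mem x hx =>
      obtain ⟨j, hj, rfl⟩ := hx
      have : k ≠ j := by rintro rfl; exact hk hj
      simp [this]
    | zero => simp
    | add x y _ _ hx hy => rw [Pi.add_apply, hx, hy, add_zero]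
    | smul a x _ hx => rw [Pi.smul_apply, hx, smul_zero]
  · intro h
    have : x = ∑ k, x k • (Pi.single k 1 : Fin (p + q) → ℂ) := by
      ext i
      simp [Pi.single_apply]
    rw [this]
    refine Submodule.sum_mem _ fun k _ => ?_
    by_cases hk : k ∈ I.1
    · exact Submodule.smul_mem _ _ (Submodule.subset_span ⟨k, hk, rfl⟩)
    · rw [h k hk, zero_smul]
      exact Submodule.zero_mem _

theorem firstColumns_mul (b g : SLn p q) :
    firstColumns p q (b * g) = (firstColumns p q g).map b.1.mulVecLin := by
  ext x
  rw [mem_map_mulVecLin_iff, mem_firstColumns_iff, mem_firstColumns_iff, _root_.mul_inv_rev,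
    SLn.val_mul, mulVec_mulVec]

theorem planeOf_smul (b : borelSubgroup p q) (x : SLn p q ⧸ parabolic p q) :
    planeOf p q (b • x) = (planeOf p q x).map b.1.1.mulVecLin := by
  induction x using QuotientGroup.induction_on with
  | H g => exact firstColumns_mul b.1 g

theorem planeOf_injective : Function.Injective (planeOf p q) := by
  intro x y
  induction x using QuotientGroup.induction_on with
  | H g =>
  induction y using QuotientGroup.induction_on with
  | H h =>
    intro (e : firstColumns p q g = firstColumns p q h)
    rw [QuotientGroup.eq]
    intro i j hij
    have hj : (j : ℕ) < p := by
      by_contra hj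
      simp only [hj, if_false] at hij
      split_ifs at hij <;> omega
    have hi : ¬ (i : ℕ) < p := by
      intro hi
      simp [hi] at hij
    have hm : (fun i => h i j) ∈ firstColumns p q g := by
      rw [e]; exact Submodule.subset_span ⟨j, hj, rfl⟩
    have := mem_firstColumns_iff.1 hm i hi
    simpa [Matrix.mul_apply, mulVec, dotProduct] using this

/-- Schubert cells with different index sets are disjoint: an upper triangular matrix keeps the
`i`-th coordinate of `e_i` nonzero. -/
theorem eq_of_mem_schubertCell {I I' : PSubset p q} {x : SLn p q ⧸ parabolic p q}
    (h : x ∈ schubertCell I) (h' : x ∈ schubertCell I') : I = I' := by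
  obtain ⟨b, hb, e⟩ := h
  obtain ⟨b', hb', e'⟩ := h'
  have hsub : I.1 ⊆ I'.1 := by
    intro i hi
    by_contra hi'
    have h1 : b.1 *ᵥ Pi.single i 1 ∈ planeOf p q x := by
      rw [e]
      exact ⟨Pi.single i 1, Submodule.subset_span ⟨i, hi, rfl⟩, rfl⟩
    rw [e', mem_map_mulVecLin_iff, mem_coordPlane_iff] at h1
    have h2 := h1 i hi'
    rw [mulVec_mulVec, ← SLn.val_mul] at h2
    exact diag_ne_zero_of_mem_borel (mul_mem (inv_mem hb') hb) i (by simpa using h2)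
  exact Subtype.ext (Finset.eq_of_subset_of_card_le hsub (by rw [I.2, I'.2]))

theorem schubertCell_eq_orbit {I : PSubset p q} {x : SLn p q ⧸ parabolic p q}
    (h : x ∈ schubertCell I) : schubertCell I = MulAction.orbit (borelSubgroup p q) x := by
  obtain ⟨b, hb, e⟩ := h
  have hmap : ∀ (g h : SLn p q) (W : Submodule ℂ (Fin (p + q) → ℂ)),
      (W.map h.1.mulVecLin).map g.1.mulVecLin = W.map (g * h).1.mulVecLin := by
    intro g h W
    rw [SLn.val_mul, mulVecLin_mul, Submodule.map_comp]
  ext y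
  constructor
  · rintro ⟨b', hb', e'⟩
    refine ⟨⟨b' * b⁻¹, mul_mem hb' (inv_mem hb)⟩, planeOf_injective ?_⟩
    change planeOf p q (_ • x) = _
    rw [planeOf_smul, e, e', hmap, inv_mul_cancel_right]
  · rintro ⟨b', rfl⟩
    refine ⟨b' * b, mul_mem b'.2 hb, ?_⟩
    change planeOf p q (b' • x) = _
    rw [planeOf_smul, e, hmap]

theorem blockSign_mulVec_eq_iff {x : Fin (p + q) → ℂ} :
    blockSign p q *ᵥ x = x ↔ ∀ k : Fin (p + q), ¬ (k : ℕ) < p → x k = 0 := by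
  rw [funext_iff]
  refine forall_congr' fun k => ?_
  rw [blockSign, mulVec_diagonal]
  by_cases hk : (k : ℕ) < p <;> simp [hk, neg_eq_iff_add_eq_zero, ← two_mul]

end Schubert

namespace PreClan

variable {p q : ℕ}

/-- The positions of signature `+`. -/
def posSet (c : PreClan p q) : PSubset p q := ⟨Finset.univ.filter c.Pos, c.pos_count⟩

theorem mem_posSet {c : PreClan p q} {i : Fin (p + q)} : i ∈ c.posSet.1 ↔ c.Pos i := by
  simp [posSet]

/-- The unipotent matrix that sends `e_i` to `e_i + e_j` if `i` is the second and `j` the first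
position of a number, and fixes all other `e_i`. It maps the coordinate plane of the positive
positions to the fixed space of the involution of the clan. -/
def unipotent (c : PreClan p q) : Matrix (Fin (p + q)) (Fin (p + q)) ℂ :=
  1 + Matrix.of fun k i => if i = c.mate k ∧ c.mate k ≠ k ∧ ¬ c.Pos k then 1 else 0

theorem unipotent_mulVec_apply (c : PreClan p q) (x : Fin (p + q) → ℂ) (k : Fin (p + q)) :
    (c.unipotent *ᵥ x) k = x k + if c.mate k ≠ k ∧ ¬ c.Pos k then x (c.mate k) else 0 := by
  rw [unipotent, add_mulVec, one_mulVec, Pi.add_apply]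
  congr 1
  simp only [mulVec, dotProduct, Matrix.of_apply, ite_mul, one_mul, zero_mul]
  split_ifs with h
  · simp [h]
  · simp [h]

theorem unipotent_upper (c : PreClan p q) {k i : Fin (p + q)} (h : i ≤ k) :
    c.unipotent k i = if k = i then 1 else 0 := by
  rw [unipotent, Matrix.add_apply, Matrix.of_apply, if_neg, add_zero, Matrix.one_apply]
  rintro ⟨rfl, h1, h2⟩
  have hm : c.Match k (c.mate k) := (mate_eq_iff_match h1.symm).1 rfl
  exact h2 ((pos_iff_of_match hm).2 (lt_of_le_of_ne h h1))

theorem exists_unipotent_mem_borel (c : PreClan p q) :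
    ∃ u ∈ borelSubgroup p q, (u : Matrix (Fin (p + q)) (Fin (p + q)) ℂ) = c.unipotent := by
  have ht : c.unipotent.BlockTriangular id := fun i j (h : j < i) => by
    rw [c.unipotent_upper h.le, if_neg h.ne']
  refine ⟨⟨c.unipotent, ?_⟩, fun i j h => ht h, rfl⟩
  rw [det_of_isUpperTriangular ht]
  exact Finset.prod_eq_one fun i _ => by rw [c.unipotent_upper le_rfl, if_pos rfl]

theorem involution_mulVec_unipotent_eq_iff (c : PreClan p q) (x : Fin (p + q) → ℂ) :
    c.involution *ᵥ (c.unipotent *ᵥ x) = c.unipotent *ᵥ x ↔ ∀ k, ¬ c.Pos k → x k = 0 := by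
  have key : ∀ k, ¬ c.Pos k → ((c.involution *ᵥ (c.unipotent *ᵥ x)) k = (c.unipotent *ᵥ x) k ↔
      x k = 0) := by
    intro k hk
    rw [involution_mulVec_apply, unipotent_mulVec_apply, unipotent_mulVec_apply]
    by_cases hm : c.mate k = k
    · have hs : c.symbol k = .minus :=
        (mate_eq_self_iff.1 hm).resolve_left fun h => hk (pos_of_plus h)
      simp [hm, sign, hs, neg_eq_iff_add_eq_zero, ← two_mul]
    · have hs : c.symbol k ≠ .minus := fun h => hm (mate_eq_self_iff.2 (Or.inr h))
      have hp : c.Pos (c.mate k) := (pos_mate_iff hm).2 hk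
      simp [hm, sign, hs, hp, hk]
  constructor
  · intro h k hk
    exact (key k hk).1 (congrFun h k)
  · intro h
    funext k
    by_cases hk : c.Pos k
    · rw [involution_mulVec_apply, unipotent_mulVec_apply, unipotent_mulVec_apply]
      have hs : c.symbol k ≠ .minus := fun h => not_pos_of_minus h hk
      by_cases hm : c.mate k = k
      · simp [hm, sign, hs, hk]
      · have hp : ¬ c.Pos (c.mate k) := fun h => (pos_mate_iff hm).1 h hk
        simp [sign, hs, hp, hk, mate_mate, Ne.symm hm, h _ hp]
    · exact (key k hk).2 (h k hk)

end PreClan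

/-! ### Sects -/

section Sects

variable {p q : ℕ}

theorem leviProj_mem_schubertCell (c : PreClan p q) {x : SLn p q ⧸ levi p q}
    (hx : x ∈ Clan.borelOrbit (Quotient.mk _ c)) : leviProj p q x ∈ schubertCell c.posSet := by
  induction x using QuotientGroup.induction_on with
  | H h =>
    obtain ⟨b, hb, e⟩ := (mem_borelOrbit_iff c h).1 hx
    obtain ⟨u, hu, hue⟩ := c.exists_unipotent_mem_borel
    refine ⟨b * u, mul_mem hb hu, ?_⟩
    change firstColumns p q h = _
    ext x
    rw [mem_map_mulVecLin_iff, mem_coordPlane_iff, mem_firstColumns_iff, ← blockSign_mulVec_eq_iff]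
    simp only [PreClan.mem_posSet]
    rw [← c.involution_mulVec_unipotent_eq_iff]
    set v := ((b * u)⁻¹ : SLn p q).1 *ᵥ x with hv
    set y := h⁻¹ * b with hy
    -- `h⁻¹ x` is `y u v`, and `y` carries the fixed space of the involution to the first `p`
    -- coordinates
    have hx : (h⁻¹ : SLn p q).1 *ᵥ x = y.1 *ᵥ (c.unipotent *ᵥ v) := by
      have hbu : h⁻¹ = y * u * (b * u)⁻¹ := by rw [hy, eq_mul_inv_iff_mul_eq, mul_assoc]
      rw [← hue, mulVec_mulVec, hv, mulVec_mulVec, ← SLn.val_mul, ← SLn.val_mul, hbu]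
    rw [hx, mulVec_mulVec (c.unipotent *ᵥ v), ← e, ← mulVec_mulVec]
    constructor
    · intro h'
      rw [← SLn.inv_mulVec_mulVec y (c.involution *ᵥ _), h', SLn.inv_mulVec_mulVec]
    · intro h'
      rw [h']

theorem Clan.ofPSubset_injective : Function.Injective (Clan.ofPSubset (p := p) (q := q)) := by
  intro I I' h
  have h' := (Quotient.exact h).1
  apply Subtype.ext
  ext i
  have := h' i
  simp only [PreClan.ofPSubset] at this
  by_cases h1 : i ∈ I.1 <;> by_cases h2 : i ∈ I'.1 <;> simp_all

theorem mem_sectOf_iff (c : PreClan p q) (I : PSubset p q) :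
    (Quotient.mk _ c : Clan p q) ∈ Clan.sectOf I ↔ c.posSet = I :=
  Clan.ofPSubset_injective.eq_iff (a := c.posSet) (b := I)

theorem preimage_schubertCell (I : PSubset p q) :
    leviProj p q ⁻¹' schubertCell I = ⋃ γ ∈ Clan.sectOf I, γ.borelOrbit := by
  ext x
  simp only [Set.mem_preimage, Set.mem_iUnion, exists_prop]
  constructor
  · intro hx
    obtain ⟨γ, hγ⟩ := exists_mem_borelOrbit x
    refine ⟨γ, ?_, hγ⟩
    induction γ using Quotient.inductionOn with
    | h c =>
      exact (mem_sectOf_iff c I).2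
        (eq_of_mem_schubertCell (leviProj_mem_schubertCell c hγ) hx)
  · rintro ⟨γ, hγI, hγ⟩
    induction γ using Quotient.inductionOn with
    | h c =>
      rw [← (mem_sectOf_iff c I).1 hγI]
      exact leviProj_mem_schubertCell c hγ

theorem posSet_ofPSubset (I : PSubset p q) : (PreClan.ofPSubset I).posSet = I := by
  apply Subtype.ext
  ext i
  rw [PreClan.mem_posSet]
  constructor
  · rintro (h | ⟨j, -, hj⟩)
    · by_contra hi
      simp [PreClan.ofPSubset, hi] at h
    · by_contra hi
      exact hj.2.2.2 (by simp [PreClan.ofPSubset, hi])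
  · intro hi
    exact Or.inl (by simp [PreClan.ofPSubset, hi])

theorem schubertCell_nonempty (I : PSubset p q) : (schubertCell I).Nonempty :=
  ⟨_, posSet_ofPSubset I ▸ leviProj_mem_schubertCell (PreClan.ofPSubset I)
    (MulAction.mem_orbit_self _)⟩

theorem exists_mem_schubertCell (x : SLn p q ⧸ parabolic p q) :
    ∃ I : PSubset p q, x ∈ schubertCell I := by
  induction x using QuotientGroup.induction_on with
  | H g =>
    obtain ⟨γ, hγ⟩ := exists_mem_borelOrbit (g : SLn p q ⧸ levi p q)
    induction γ using Quotient.inductionOn with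
    | h c => exact ⟨_, leviProj_mem_schubertCell c hγ⟩

theorem bijOn_schubertCell :
    Set.BijOn (fun I : PSubset p q => schubertCell I) Set.univ (schubertCells p q) := by
  refine ⟨?_, ?_, ?_⟩
  · intro I _
    obtain ⟨x, hx⟩ := schubertCell_nonempty I
    exact ⟨x, (schubertCell_eq_orbit hx).symm⟩
  · intro I _ I' _ (h : schubertCell I = schubertCell I')
    obtain ⟨x, hx⟩ := schubertCell_nonempty I
    exact eq_of_mem_schubertCell hx (h ▸ hx)
  · rintro _ ⟨x, rfl⟩
    obtain ⟨I, hI⟩ := exists_mem_schubertCell x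
    exact ⟨I, Set.mem_univ _, schubertCell_eq_orbit hI⟩

theorem bijOn_sectOf :
    Set.BijOn (fun I : PSubset p q => Clan.sectOf I) Set.univ (sects p q) := by
  have hmem : ∀ I : PSubset p q, Clan.ofPSubset I ∈ Clan.sectOf I := fun I =>
    (mem_sectOf_iff _ I).2 (posSet_ofPSubset I)
  refine ⟨?_, ?_, ?_⟩
  · intro I _
    exact ⟨Clan.ofPSubset I, congrArg Clan.sect (hmem I)⟩
  · intro I _ I' _ (h : Clan.sectOf I = Clan.sectOf I')
    have := (mem_sectOf_iff _ I').1 (h ▸ hmem I)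
    rwa [posSet_ofPSubset] at this
  · rintro _ ⟨γ, rfl⟩
    induction γ using Quotient.inductionOn with
    | h c => exact ⟨c.posSet, Set.mem_univ _, rfl⟩

end Sects

/-! ### Lattice paths -/

namespace LatticePath

variable {p q : ℕ}

theorem ext_pt {P Q : LatticePath p q} (h : P.pt = Q.pt) : P = Q := by
  cases P; cases Q; cases h; rfl

/-- The number of east and north steps among the first `k` steps of the path that goes east at the
steps in `I` and north at all others. -/
def count (I : Finset (Fin (p + q))) (k : Fin (p + q + 1)) : ℕ × ℕ :=
  ((I.filter fun i => i.castSucc < k).card, (Iᶜ.filter fun i => i.castSucc < k).card)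

theorem count_zero (I : Finset (Fin (p + q))) : count I 0 = (0, 0) := by
  simp [count]

theorem count_last (I : Finset (Fin (p + q))) : count I (Fin.last (p + q)) = (I.card, Iᶜ.card) := by
  simp [count, Fin.castSucc_lt_last]

theorem count_succ (I : Finset (Fin (p + q))) (i : Fin (p + q)) :
    count I i.succ = count I i.castSucc + if i ∈ I then (1, 0) else (0, 1) := by
  have key : ∀ A : Finset (Fin (p + q)), (A.filter fun j => j.castSucc < i.succ).card
      = (A.filter fun j => j.castSucc < i.castSucc).card + if i ∈ A then 1 else 0 := by
    intro A
    have h1 : (A.filter fun j => j.castSucc < i.succ)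
        = (A.filter fun j => j.castSucc < i.castSucc) ∪ A.filter fun j => j = i := by
      ext j
      simp only [Finset.mem_filter, Finset.mem_union, Fin.castSucc_lt_succ_iff,
        Fin.castSucc_lt_castSucc_iff, le_iff_lt_or_eq]
      tauto
    rw [h1, Finset.card_union_of_disjoint]
    · congr 1
      rw [Finset.filter_eq']
      split_ifs <;> simp
    · rw [Finset.disjoint_filter]
      rintro j - hj rfl
      exact lt_irrefl _ hj
  simp only [count, key, Finset.mem_compl]
  by_cases h : i ∈ I <;> simp [h]

theorem pt_eq_count {f : Fin (p + q + 1) → ℕ × ℕ} {I : Finset (Fin (p + q))} (h0 : f 0 = (0, 0))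
    (hs : ∀ i : Fin (p + q), f i.succ = f i.castSucc + if i ∈ I then (1, 0) else (0, 1)) :
    f = count I := by
  funext k
  induction k using Fin.induction with
  | zero => rw [h0, count_zero]
  | succ i ih => rw [hs, count_succ, ih]

/-- The lattice path that goes east at the steps in `I` and north at all others. -/
def ofPSubset (I : PSubset p q) : LatticePath p q where
  pt := count I.1
  start := count_zero I.1
  finish := by
    rw [count_last, Finset.card_compl, I.2, Fintype.card_fin, Nat.add_sub_cancel_left]
  step i := by
    rw [count_succ]
    split_ifs
    · exact Or.inl rfl
    · exact Or.inr rfl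

theorem ofPSubset_bijective : Function.Bijective (ofPSubset (p := p) (q := q)) := by
  constructor
  · intro I I' h
    have h' : count I.1 = count I'.1 := congrArg pt h
    apply Subtype.ext
    ext i
    have h1 := count_succ I.1 i
    rw [h', count_succ, add_right_inj] at h1
    by_cases hi : i ∈ I.1 <;> by_cases hi' : i ∈ I'.1 <;> simp_all
  · intro P
    set A : Finset (Fin (p + q)) :=
      Finset.univ.filter fun i => P.pt i.succ = P.pt i.castSucc + (1, 0) with hA
    have hP : P.pt = count A := by
      refine pt_eq_count P.start fun i => ?_
      by_cases hi : P.pt i.succ = P.pt i.castSucc + (1, 0)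
      · simp [hA, hi]
      · simpa [hA, hi] using (P.step i).resolve_left hi
    have hc : A.card = p := by
      have := P.finish
      rw [hP, count_last] at this
      exact congrArg Prod.fst this
    exact ⟨⟨A, hc⟩, ext_pt hP.symm⟩

end LatticePath

end

theorem theorem4 (p q : ℕ) (hp : 0 < p) (hq : 0 < q) :
    -- the orbit `R_γ` does not depend on the choice of the default matrix
    (∀ (γ : Clan p q) (g : SLn p q), γ.IsDefaultMatrix g →
      γ.borelOrbit =
        MulAction.orbit (borelSubgroup p q) ((g⁻¹ : SLn p q) : SLn p q ⧸ levi p q)) ∧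
    -- the sets `C_I` are exactly the Borel orbits in `SL_n / P_{p,q}`, without repetition
    Set.BijOn (fun I : PSubset p q => schubertCell I) Set.univ (schubertCells p q) ∧
    -- the preimage of `C_I` is the disjoint union of the `R_γ` with `γ ∈ Σ_I`
    (∀ I : PSubset p q,
      leviProj p q ⁻¹' schubertCell I = (⋃ γ ∈ Clan.sectOf I, γ.borelOrbit) ∧
      (Clan.sectOf I).PairwiseDisjoint Clan.borelOrbit) ∧
    -- `C_I ↔ Σ_I` is a bijection between Schubert cells and sects
    (∃ Φ : schubertCells p q ≃ sects p q, ∀ (I : PSubset p q) (C : schubertCells p q),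
      (C : Set (SLn p q ⧸ parabolic p q)) = schubertCell I →
        (Φ C : Set (Clan p q)) = Clan.sectOf I) ∧
    -- sects are in bijection with lattice paths: the `i`-th step of the path of `Σ_I` goes east
    -- if `i ∈ I` and north otherwise
    (∃ Ψ : sects p q ≃ LatticePath p q, ∀ (I : PSubset p q) (S : sects p q),
      (S : Set (Clan p q)) = Clan.sectOf I → ∀ i : Fin (p + q),
        (Ψ S).pt i.succ = (Ψ S).pt i.castSucc + (if i ∈ I.1 then (1, 0) else (0, 1))) := by
  let eC : PSubset p q ≃ schubertCells p q :=
    (Equiv.Set.univ _).symm.trans (bijOn_schubertCell (p := p) (q := q)).equiv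
  let eS : PSubset p q ≃ sects p q :=
    (Equiv.Set.univ _).symm.trans (bijOn_sectOf (p := p) (q := q)).equiv
  refine ⟨borelOrbit_eq_of_isDefaultMatrix, bijOn_schubertCell, fun I =>
    ⟨preimage_schubertCell I, ?_⟩, ⟨eC.symm.trans eS, ?_⟩,
    ⟨eS.symm.trans (Equiv.ofBijective _ LatticePath.ofPSubset_bijective), ?_⟩⟩
  · intro γ _ δ _ hne
    exact Set.disjoint_left.2 fun x h1 h2 => hne (eq_of_mem_borelOrbit h1 h2)
  · intro I C hC
    have : C = eC I := Subtype.ext hC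
    rw [this, Equiv.trans_apply, Equiv.symm_apply_apply]
    rfl
  · intro I S hS i
    have : S = eS I := Subtype.ext hS
    rw [this, Equiv.trans_apply, Equiv.symm_apply_apply]
    exact LatticePath.count_succ I.1 i
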